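/- Let $\lambda_0,\lambda_1>0$ and let $\varepsilon=(\varepsilon(t))_{t\ge0}$ be the two-state continuous-time Markov chain on $\{0,1\}$ with transition intensities $\lambda_0$ (from $0$ to $1$) and $\lambda_1$ (from $1$ to $0$); $\mathbb P_i$ and $\mathbb E_i$ refer to the initial state $\varepsilon(0)=i$. Let $a_0,a_1\in\mathbb R$, $\gamma_0,\gamma_1>0$, and assume $\rho_0:=a_0/\gamma_0<\rho_1:=a_1/\gamma_1$. Let $X$ be the Kac–Ornstein–Uhlenbeck process started from $x\in\mathbb R$, that is, the continuous process with \[ X(t)=x+\int_0^t\bigl(a_{\varepsilon(s)}-\gamma_{\varepsilon(s)}X(s)\bigr)\,ds,\qquad t\ge0, \] let $T(x,y)=\inf\{t>0:\ X(t)=y\}\in[0,\infty]$ (with $\inf\emptyset=\infty$), and for $q\ge0$ let $\ell_i(q,x,y)=\mathbb E_i\bigl[e^{-qT(x,y)}\bigr]$, $i\in\{0,1\}$, where $e^{-qT}:=0$ on $\{T=\infty\}$. Put \[ \beta_i=\frac{q+\lambda_i}{\gamma_i},\qquad b_{0,1}=\frac12\Bigl(\beta_0+\beta_1\pm\sqrt{(\beta_0-\beta_1)^2+\tfrac{4\lambda_0\lambda_1}{\gamma_0\gamma_1}}\Bigr),\qquad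 \xi_0(x)=\frac{x-\rho_0}{\rho_1-\rho_0},\qquad \xi_1(x)=\frac{\rho_1-x}{\rho_1-\rho_0}, \] and let $F(b_0,b_1;c;z)=\sum_{n\ge0}\frac{(b_0)_n(b_1)_n}{(c)_n\,n!}z^n$ $(|z|<1)$ be the Gauss hypergeometric function. (a) If $\rho_0\le y<\rho_1$ and $2\rho_0-\rho_1<x<y$, then \[ \ell_0(q,x,y)=\frac{\lambda_0}{q+\lambda_0}\cdot\frac{F(b_0,b_1;1+\beta_0;\xi_0(x))}{F(b_0,b_1;\beta_0;\xi_0(y))},\qquad \ell_1(q,x,y)=\frac{F(b_0,b_1;\beta_0;\xi_0(x))}{F(b_0,b_1;\beta_0;\xi_0(y))}. \] (b) If $\rho_0<y\le\rho_1$ and $y<x<2\rho_1-\rho_0$, then \[ \ell_0(q,x,y)=\frac{F(b_0,b_1;\beta_1;\xi_1(x))}{F(b_0,b_1;\beta_1;\xi_1(y))},\qquad \ell_1(q,x,y)=\frac{\lambda_1}{q+\lambda_1}\cdot\frac{F(b_0,b_1;1+\beta_1;\xi_1(x))}{F(b_0,b_1;\beta_1;\xi_1(y))}. \] -/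

import Mathlib

open MeasureTheory ProbabilityTheory

namespace KacOU

noncomputable section

/-! ### The two-state Markov chain -/

/-- The state occupied after `n` switches by a chain on `{0, 1}` that starts from `i`. -/
def stateAfter (i : Fin 2) (n : ℕ) : Fin 2 := if Even n then i else 1 - i

/-- The time of the `n`-th switch (with `jumpTime S 0 = 0`), if `S k` is the `k`-th holding time. -/
def jumpTime {Ω : Type*} (S : ℕ → Ω → ℝ) (n : ℕ) (ω : Ω) : ℝ :=
  ∑ k ∈ Finset.range n, S k ω

/-- Under `μ`, the process `(ε t)_{t ≥ 0}` is the right-continuous Markov chain on `{0, 1}` with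
transition intensities `0 → 1` equal to `lam 0` and `1 → 0` equal to `lam 1`, started from `i`:
it switches between the two states, and the successive holding times are independent, a holding
time in the state `j` being exponential with rate `lam j`. -/
def IsTwoStateChain {Ω : Type*} [MeasurableSpace Ω] (μ : Measure Ω) (lam : Fin 2 → ℝ)
    (i : Fin 2) (ε : ℝ → Ω → Fin 2) : Prop :=
  ∃ S : ℕ → Ω → ℝ,
    (∀ n, Measurable (S n)) ∧
    (∀ n, μ.map (S n) = expMeasure (lam (stateAfter i n))) ∧
    iIndepFun S μ ∧
    ∀ᵐ ω ∂μ, ∀ (n : ℕ) (t : ℝ), jumpTime S n ω ≤ t → t < jumpTime S (n + 1) ω →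
      ε t ω = stateAfter i n

/-! ### The process and its first passage times -/

/-- Almost surely, the path `(X t)_{t ≥ 0}` is continuous and
`X t = x + ∫₀ᵗ (a_{ε(s)} - γ_{ε(s)} X(s)) ds` for all `t ≥ 0`. -/
def IsKacOU {Ω : Type*} [MeasurableSpace Ω] (μ : Measure Ω) (a γ : Fin 2 → ℝ)
    (ε : ℝ → Ω → Fin 2) (x : ℝ) (X : ℝ → Ω → ℝ) : Prop :=
  ∀ᵐ ω ∂μ, ContinuousOn (fun t => X t ω) (Set.Ici 0) ∧
    ∀ t : ℝ, 0 ≤ t → X t ω = x + ∫ s in (0 : ℝ)..t, (a (ε s ω) - γ (ε s ω) * X s ω)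

/-- The first passage time `inf {t > 0 : X t = y}`, equal to `∞` if there is no such `t`. -/
def passageTime {Ω : Type*} (X : ℝ → Ω → ℝ) (y : ℝ) (ω : Ω) : ENNReal :=
  sInf (ENNReal.ofReal '' {t : ℝ | 0 < t ∧ X t ω = y})

/-- `e^{-qT}` for `T ∈ [0, ∞]`, with `e^{-q∞} = 0` (also for `q = 0`). -/
def expNeg (q : ℝ) (T : ENNReal) : ℝ :=
  if T = ⊤ then 0 else Real.exp (-q * T.toReal)

/-- The Laplace transform `E[e^{-qT}]` of a `[0, ∞]`-valued random time `T`. -/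
def laplace {Ω : Type*} [MeasurableSpace Ω] (μ : Measure Ω) (T : Ω → ENNReal) (q : ℝ) : ℝ :=
  ∫ ω, expNeg q (T ω) ∂μ

/-! ### Parameters of the explicit formulas -/

/-- The attraction levels `ρᵢ = aᵢ / γᵢ`. -/
def rho (a γ : Fin 2 → ℝ) (i : Fin 2) : ℝ := a i / γ i

/-- `βᵢ(q) = (q + λᵢ) / γᵢ`. -/
def beta (γ lam : Fin 2 → ℝ) (q : ℝ) (i : Fin 2) : ℝ := (q + lam i) / γ i

/-- The square root `√((β₀ - β₁)² + 4 λ₀ λ₁ / (γ₀ γ₁))`. -/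
def discr (γ lam : Fin 2 → ℝ) (q : ℝ) : ℝ :=
  Real.sqrt ((beta γ lam q 0 - beta γ lam q 1) ^ 2 + 4 * lam 0 * lam 1 / (γ 0 * γ 1))

/-- The parameter `b₀`. -/
def b0 (γ lam : Fin 2 → ℝ) (q : ℝ) : ℝ :=
  (beta γ lam q 0 + beta γ lam q 1 + discr γ lam q) / 2

/-- The parameter `b₁`. -/
def b1 (γ lam : Fin 2 → ℝ) (q : ℝ) : ℝ :=
  (beta γ lam q 0 + beta γ lam q 1 - discr γ lam q) / 2

/-- `ξ₀(x) = (x - ρ₀) / (ρ₁ - ρ₀)`. -/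
def xi0 (a γ : Fin 2 → ℝ) (x : ℝ) : ℝ := (x - rho a γ 0) / (rho a γ 1 - rho a γ 0)

/-- `ξ₁(x) = (ρ₁ - x) / (ρ₁ - ρ₀)`. -/
def xi1 (a γ : Fin 2 → ℝ) (x : ℝ) : ℝ := (rho a γ 1 - x) / (rho a γ 1 - rho a γ 0)

/-- `F(b₀, b₁; c; z)`, the Gauss hypergeometric function with the parameters `b₀(q), b₁(q)`. -/
def F (γ lam : Fin 2 → ℝ) (q c z : ℝ) : ℝ :=
  ordinaryHypergeometric (b0 γ lam q) (b1 γ lam q) c z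

end

end KacOU

namespace KacOU

/-! ### Differential relations between contiguous hypergeometric functions -/

section Hypergeometric

open Filter Topology

/-! The claimed formulas, as functions `u j` of the starting level, solve the backward equations `γ
j (ρ j - z) (u j)' = (q + λ j) u j - λ j u (1 - j)` with `u 1 y = 1`. With `c = β₀`, these are two
contiguous relations between `F(b₀, b₁; c; ·)` and `F(b₀, b₁; 1 + c; ·)`, checked coefficientwise
(`ordinaryHypergeometric_contiguous`, `backwardSystem_passageLaplace`). No condition is imposed on
`u 0` at `y`: from below, `y` is reached only in state `1`. Smoothness at the singular point `ρ₀`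
takes its place.

Any such solution is the Laplace transform, by optional stopping along the switching times alone.
Between switches the path is an explicit exponential flow, so the stopped path at these times is a
deterministic recursion in the independent holding times (`skeleton`, matched with the process in
`skeleton_dichotomy`). Along the flow the backward equation is an exact derivative, so the
discounted value has constant expectation (`BackwardSystem.integral_stepVal`,
`BackwardSystem.integral_stoppedVal_succ`). Almost surely some state-`1` holding time is long enough
to carry the path to `y`; from then on the discounted value equals `e^{-qT}`, and dominated
convergence concludes (`BackwardSystem.laplace_passageTime`).

Part (b) is part (a) for `-X` with the two states exchanged. -/

theorem summable_norm_mul_pow_of_bounded {c : ℕ → ℝ}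
    (hc : ∀ r : ℝ, 0 < r → r < 1 → ∃ C, ∀ n, |c n| * r ^ n ≤ C) {r : ℝ} (h0 : 0 < r) (h1 : r < 1) :
    Summable fun n => |c n| * (n * r ^ (n - 1)) := by
  -- The intermediate radius `s` absorbs the factor `n`: the terms are dominated by a multiple of `n
  -- (r / s) ^ n`.
  obtain ⟨s, hrs, hs⟩ := exists_between h1
  have hs0 : 0 < s := h0.trans hrs
  obtain ⟨C, hC⟩ := hc s hs0 hs
  have hq : r / s < 1 := (div_lt_one hs0).2 hrs
  have hn : ‖r / s‖ < 1 := by rwa [Real.norm_of_nonneg (by positivity)]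
  have hsum : Summable fun n : ℕ => C / r * ((n : ℝ) ^ 1 * (r / s) ^ n) :=
    (summable_pow_mul_geometric_of_norm_lt_one (R := ℝ) 1 hn).mul_left (C / r)
  refine hsum.of_nonneg_of_le (fun n => by positivity) fun n => ?_
  rcases n with _ | n
  · simp
  · have h := hC (n + 1)
    have e : |c (n + 1)| * (((n + 1 : ℕ) : ℝ) * r ^ (n + 1 - 1))
        = (|c (n + 1)| * s ^ (n + 1)) * (((n + 1 : ℕ) : ℝ) / r * (r / s) ^ (n + 1)) := by
      rw [Nat.add_sub_cancel, div_pow]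
      field_simp
      ring
    rw [e]
    calc _ ≤ C * (((n + 1 : ℕ) : ℝ) / r * (r / s) ^ (n + 1)) := by gcongr
      _ = _ := by ring

theorem hasDerivAt_tsum_mul_pow {c : ℕ → ℝ}
    (hc : ∀ r : ℝ, 0 < r → r < 1 → ∃ C, ∀ n, |c n| * r ^ n ≤ C) {z : ℝ} (hz : |z| < 1) :
    Summable (fun n => c n * z ^ n) ∧ Summable (fun n => c n * (n * z ^ (n - 1))) ∧
    HasDerivAt (fun z => ∑' n, c n * z ^ n) (∑' n, c n * (n * z ^ (n - 1))) z := by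
  obtain ⟨r, hzr, hr⟩ := exists_between hz
  have hr0 : 0 < r := (abs_nonneg z).trans_lt hzr
  have hu := summable_norm_mul_pow_of_bounded hc hr0 hr
  have hg : ∀ (n : ℕ) (w : ℝ), w ∈ Set.Ioo (-r) r →
      HasDerivAt (fun w => c n * w ^ n) (c n * (n * w ^ (n - 1))) w := fun n w _ =>
    (hasDerivAt_pow n w).const_mul (c n)
  have hb : ∀ (n : ℕ) (w : ℝ), w ∈ Set.Ioo (-r) r →
      ‖c n * (n * w ^ (n - 1))‖ ≤ |c n| * (n * r ^ (n - 1)) := by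
    intro n w hw
    rw [norm_mul, norm_mul, norm_pow, Real.norm_eq_abs, Real.norm_eq_abs w, Real.norm_natCast]
    have := abs_lt.2 hw
    gcongr
  have hz' : z ∈ Set.Ioo (-r) r := abs_lt.1 hzr
  have h0 : Summable fun n => c n * (0 : ℝ) ^ n :=
    summable_of_ne_finset_zero (s := {0}) fun n hn => by
      rw [zero_pow (by simpa using hn), mul_zero]
  have h00 : (0 : ℝ) ∈ Set.Ioo (-r) r := ⟨by linarith, hr0⟩
  have h1 := summable_of_summable_hasDerivAt_of_isPreconnected (𝕜 := ℝ) (F := ℝ)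
    (g := fun n w => c n * w ^ n) (g' := fun n w => c n * (n * w ^ (n - 1))) hu isOpen_Ioo
    isPreconnected_Ioo hg hb h00 h0 hz'
  have h2 := hasDerivAt_tsum_of_isPreconnected (𝕜 := ℝ) (F := ℝ)
    (g := fun n w => c n * w ^ n) (g' := fun n w => c n * (n * w ^ (n - 1))) hu isOpen_Ioo
    isPreconnected_Ioo hg hb h00 h0 hz'
  exact ⟨h1, Summable.of_norm_bounded hu fun n => hb n z hz', h2⟩

/-- The case `b = 0` must be included because `b₁` vanishes when `q = 0`; the series is then a
polynomial with infinite radius. -/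
theorem one_le_radius_ordinaryHypergeometricSeries {a b c : ℝ} (ha : 0 < a) (hb : 0 ≤ b)
    (hc : 0 < c) : 1 ≤ (ordinaryHypergeometricSeries ℝ a b c).radius := by
  rcases hb.eq_or_lt with rfl | hb
  · have := ordinaryHypergeometric_radius_top_of_neg_nat₂ ℝ a c (k := 0)
    simp only [Nat.cast_zero, neg_zero] at this
    rw [this]
    exact le_top
  · rw [ordinaryHypergeometricSeries_radius_eq_one]
    intro k
    have : (0 : ℝ) ≤ k := k.cast_nonneg
    refine ⟨?_, ?_, ?_⟩ <;> linarith

theorem bounded_ordinaryHypergeometricCoefficient {a b c : ℝ} (ha : 0 < a) (hb : 0 ≤ b)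
    (hc : 0 < c) (r : ℝ) (h0 : 0 < r) (h1 : r < 1) :
    ∃ C, ∀ n, |ordinaryHypergeometricCoefficient a b c n| * r ^ n ≤ C := by
  lift r to NNReal using h0.le
  have hr : (r : ENNReal) < (ordinaryHypergeometricSeries ℝ a b c).radius :=
    lt_of_lt_of_le (by exact_mod_cast h1) (one_le_radius_ordinaryHypergeometricSeries ha hb hc)
  obtain ⟨C, -, hC⟩ := FormalMultilinearSeries.norm_mul_pow_le_of_lt_radius _ hr
  refine ⟨C, fun n => (le_of_eq ?_).trans (hC n)⟩
  rw [ordinaryHypergeometricSeries, FormalMultilinearSeries.ofScalars_norm, Real.norm_eq_abs]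

theorem ordinaryHypergeometric_eq_tsum_coefficient (a b c z : ℝ) :
    ordinaryHypergeometric a b c z = ∑' n, ordinaryHypergeometricCoefficient a b c n * z ^ n := by
  rw [ordinaryHypergeometric_eq_tsum]
  rfl

theorem ascPochhammer_eval_nonneg {s : ℝ} (hs : 0 ≤ s) (n : ℕ) :
    0 ≤ (ascPochhammer ℝ n).eval s := by
  induction n with
  | zero => simp
  | succ n ih =>
    rw [ascPochhammer_succ_eval]
    positivity

theorem ordinaryHypergeometricCoefficient_nonneg {a b c : ℝ} (ha : 0 ≤ a) (hb : 0 ≤ b)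
    (hc : 0 < c) (n : ℕ) : 0 ≤ ordinaryHypergeometricCoefficient a b c n := by
  have h : ∀ s : ℝ, 0 ≤ s → 0 ≤ (ascPochhammer ℝ n).eval s := fun s hs =>
    ascPochhammer_eval_nonneg hs n
  unfold ordinaryHypergeometricCoefficient
  have := h a ha; have := h b hb; have := h c hc.le
  positivity

theorem ordinaryHypergeometricCoefficient_succ (a b : ℝ) {c : ℝ} (hc : 0 < c) (n : ℕ) :
    (n + 1) * (c + n) * ordinaryHypergeometricCoefficient a b c (n + 1) =
      (a + n) * (b + n) * ordinaryHypergeometricCoefficient a b c n := by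
  have h1 := (ascPochhammer_pos n c hc).ne'
  have h2 : c + n ≠ 0 := by positivity
  have h3 : (n.factorial : ℝ) ≠ 0 := by positivity
  simp only [ordinaryHypergeometricCoefficient, ascPochhammer_succ_eval, Nat.factorial_succ]
  push_cast
  field_simp

/-- Both `(c)_n (c + n)` and `c (1 + c)_n` are `(c)_{n+1}`. -/
theorem ordinaryHypergeometricCoefficient_one_add (a b : ℝ) {c : ℝ} (hc : 0 < c) (n : ℕ) :
    (c + n) * ordinaryHypergeometricCoefficient a b (1 + c) n =
      c * ordinaryHypergeometricCoefficient a b c n := by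
  have h1 := (ascPochhammer_pos n c hc).ne'
  have h4 := (ascPochhammer_pos n (1 + c) (by positivity)).ne'
  have h2 : c + n ≠ 0 := by positivity
  have key : c * (ascPochhammer ℝ n).eval (1 + c) = (ascPochhammer ℝ n).eval c * (c + n) := by
    rw [← ascPochhammer_succ_eval, ascPochhammer_succ_left, add_comm 1 c]
    simp
  simp only [ordinaryHypergeometricCoefficient]
  generalize (ascPochhammer ℝ n).eval a = A
  generalize (ascPochhammer ℝ n).eval b = B
  field_simp
  linear_combination -(A * B) * key

theorem one_le_ordinaryHypergeometric {a b c z : ℝ} (ha : 0 < a) (hb : 0 ≤ b) (hc : 0 < c)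
    (h0 : 0 ≤ z) (h1 : z < 1) : 1 ≤ ordinaryHypergeometric a b c z := by
  rw [ordinaryHypergeometric_eq_tsum_coefficient]
  have h := (hasDerivAt_tsum_mul_pow (bounded_ordinaryHypergeometricCoefficient ha hb hc)
    (z := z) (by rwa [abs_of_nonneg h0])).1
  refine le_trans (le_of_eq ?_) (h.le_tsum 0 fun n _ =>
    mul_nonneg (ordinaryHypergeometricCoefficient_nonneg ha.le hb hc n) (by positivity))
  simp [ordinaryHypergeometricCoefficient]

/-- `z G' = c (H - G)` and `c (1 - z) H' = c (a + b - c) H - (c (a + b - c) - a b) G`, for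
`H = F(a, b; c; ·)` and `G = F(a, b; 1 + c; ·)`. -/
theorem ordinaryHypergeometric_contiguous {a b c z : ℝ} (ha : 0 < a) (hb : 0 ≤ b) (hc : 0 < c)
    (hz : |z| < 1) :
    ∃ G' H' : ℝ, HasDerivAt (ordinaryHypergeometric a b (1 + c)) G' z ∧
      HasDerivAt (ordinaryHypergeometric a b c) H' z ∧
      z * G' = c * (ordinaryHypergeometric a b c z - ordinaryHypergeometric a b (1 + c) z) ∧
      c * ((1 - z) * H') = c * (a + b - c) * ordinaryHypergeometric a b c z -
        (c * (a + b - c) - a * b) * ordinaryHypergeometric a b (1 + c) z := by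
  obtain ⟨sH, sH', dH⟩ := hasDerivAt_tsum_mul_pow
    (bounded_ordinaryHypergeometricCoefficient ha hb hc) hz
  obtain ⟨sG, sG', dG⟩ := hasDerivAt_tsum_mul_pow
    (bounded_ordinaryHypergeometricCoefficient ha hb (show 0 < 1 + c by positivity)) hz
  have eH : ordinaryHypergeometric a b c =
      fun z => ∑' n, ordinaryHypergeometricCoefficient a b c n * z ^ n :=
    funext (ordinaryHypergeometric_eq_tsum_coefficient a b c)
  have eG : ordinaryHypergeometric a b (1 + c) =
      fun z => ∑' n, ordinaryHypergeometricCoefficient a b (1 + c) n * z ^ n :=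
    funext (ordinaryHypergeometric_eq_tsum_coefficient a b (1 + c))
  have hpow : ∀ n : ℕ, z * ((n : ℝ) * z ^ (n - 1)) = n * z ^ n := by
    intro n
    rcases n with _ | n
    · simp
    · rw [Nat.add_sub_cancel]; ring
  rw [eH, eG]
  refine ⟨_, _, dG, dH, ?_, ?_⟩
  · rw [← sub_eq_zero]
    have h := (((sG'.hasSum.mul_left z).sub ((sH.hasSum.sub sG.hasSum).mul_left c)))
    refine h.unique ?_
    convert! hasSum_zero using 2 with n
    have h1 := ordinaryHypergeometricCoefficient_one_add a b hc n
    have h2 := hpow n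
    linear_combination ordinaryHypergeometricCoefficient a b (1 + c) n * h2 + z ^ n * h1
  -- The series of `H'` is shifted by one (its zeroth term vanishes), so that coefficients of `z ^
  -- n` can be compared.
  · have sS : HasSum (fun n => ordinaryHypergeometricCoefficient a b c (n + 1) *
        (((n + 1 : ℕ) : ℝ) * z ^ n))
        (∑' n, ordinaryHypergeometricCoefficient a b c n * (n * z ^ (n - 1))) := by
      have := (hasSum_nat_add_iff' 1).2 sH'.hasSum
      simpa using this
    have h := ((sS.sub (sH'.hasSum.mul_left z)).mul_left c).sub
      ((sH.hasSum.mul_left (c * (a + b - c))).sub (sG.hasSum.mul_left (c * (a + b - c) - a * b)))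
    rw [← sub_eq_zero]
    refine (Eq.trans ?_ (h.unique ?_))
    · ring
    convert! hasSum_zero using 2 with n
    have h1 := ordinaryHypergeometricCoefficient_one_add a b hc n
    have h2 := hpow n
    have h3 := ordinaryHypergeometricCoefficient_succ a b hc n
    have h4 : (c + n : ℝ) ≠ 0 := by positivity
    generalize ordinaryHypergeometricCoefficient a b c n = h at *
    generalize ordinaryHypergeometricCoefficient a b c (n + 1) = h' at *
    generalize ordinaryHypergeometricCoefficient a b (1 + c) n = g at *
    -- All coefficients are expressed through `h`; what remains is a rational identity in `n`.
    have hg : g = c * h / (c + n) := by field_simp; linear_combination h1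
    have h5 : (n + 1 : ℝ) * h' = (a + n) * (b + n) * h / (c + n) := by
      field_simp; linear_combination h3
    push_cast
    rw [mul_left_comm z, h2, show h' * (((n : ℝ) + 1) * z ^ n) = (n + 1) * h' * z ^ n by ring,
      h5, hg]
    field_simp
    ring

end Hypergeometric

/-! ### The flow between switches -/

section Flow

open Filter Topology

/-- The solution at time `t` of `z' = g (ρ - z)` started from `z`. -/
noncomputable def flow (ρ g t z : ℝ) : ℝ := ρ + (z - ρ) * Real.exp (-(g * t))

theorem flow_zero (ρ g z : ℝ) : flow ρ g 0 z = z := by simp [flow]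

theorem hasDerivAt_flow (ρ g z s : ℝ) :
    HasDerivAt (fun s => flow ρ g s z) (g * (ρ - flow ρ g s z)) s := by
  have h : HasDerivAt (fun s : ℝ => -(g * s)) (-g) s := by
    simpa using ((hasDerivAt_id s).const_mul g).fun_neg
  refine ((h.exp.const_mul (z - ρ)).const_add ρ).congr_deriv ?_
  unfold flow
  ring

/-- The flow is a convex combination of `z` and `ρ` with positive weight on `z`, so the inequality
stays strict even for `ρ = y`. -/
theorem flow_lt_of_le {ρ g t z y : ℝ} (hρ : ρ ≤ y) (hz : z < y) (ht : 0 ≤ g * t) :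
    flow ρ g t z < y := by
  have h0 := Real.exp_pos (-(g * t))
  have h1 : Real.exp (-(g * t)) ≤ 1 := Real.exp_le_one_iff.2 (by linarith)
  unfold flow
  nlinarith

theorem le_flow {ρ g t z m : ℝ} (hρ : m ≤ ρ) (hz : m ≤ z) (ht : 0 ≤ g * t) :
    m ≤ flow ρ g t z := by
  have h0 := Real.exp_pos (-(g * t))
  have h1 : Real.exp (-(g * t)) ≤ 1 := Real.exp_le_one_iff.2 (by linarith)
  unfold flow
  nlinarith

/-- The time the flow towards `ρ` needs from `z` to `y`, for `z ≤ y < ρ`. -/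
noncomputable def hitTime (ρ g y z : ℝ) : ℝ := max 0 (Real.log ((ρ - z) / (ρ - y)) / g)

theorem hitTime_nonneg (ρ g y z : ℝ) : 0 ≤ hitTime ρ g y z := le_max_left _ _

theorem hitTime_eq {ρ g y z : ℝ} (hg : 0 < g) (hz : z ≤ y) (hy : y < ρ) :
    hitTime ρ g y z = Real.log ((ρ - z) / (ρ - y)) / g := by
  refine max_eq_right (div_nonneg (Real.log_nonneg ?_) hg.le)
  rw [one_le_div (by linarith)]
  linarith

theorem hitTime_self {ρ g y : ℝ} (hy : y < ρ) : hitTime ρ g y y = 0 := by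
  rw [hitTime, div_self (by linarith), Real.log_one, zero_div, max_self]

theorem hitTime_antitone {ρ g y z z' : ℝ} (hg : 0 < g) (hzz : z ≤ z') (hz : z' ≤ y) (hy : y < ρ) :
    hitTime ρ g y z' ≤ hitTime ρ g y z := by
  have h1 : 0 < ρ - y := by linarith
  have h2 : 0 < ρ - z' := by linarith
  rw [hitTime_eq hg hz hy, hitTime_eq hg (hzz.trans hz) hy]
  gcongr

theorem flow_hitTime {ρ g y z : ℝ} (hg : 0 < g) (hz : z ≤ y) (hy : y < ρ) :
    flow ρ g (hitTime ρ g y z) z = y := by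
  have h1 : 0 < ρ - y := by linarith
  have h2 : 0 < ρ - z := by linarith
  rw [flow, hitTime_eq hg hz hy, mul_div_cancel₀ _ hg.ne', Real.exp_neg, Real.exp_log (by positivity)]
  field_simp
  ring

theorem flow_lt_of_lt_hitTime {ρ g y z t : ℝ} (hg : 0 < g) (hz : z ≤ y) (hy : y < ρ)
    (ht : t < hitTime ρ g y z) : flow ρ g t z < y := by
  conv_rhs => rw [← flow_hitTime hg hz hy]
  have : Real.exp (-(g * hitTime ρ g y z)) < Real.exp (-(g * t)) := by
    gcongr
  unfold flow
  nlinarith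

/-- The time spent below `y` between two switches, if the path enters the state `j` at `z ≤ y` and
the holding time is `s`. -/
noncomputable def sojourn (a γ : Fin 2 → ℝ) (y : ℝ) (j : Fin 2) (s z : ℝ) : ℝ :=
  if j = 1 then min (max s 0) (hitTime (rho a γ 1) (γ 1) y z) else if z < y then max s 0 else 0

theorem sojourn_nonneg (a γ : Fin 2 → ℝ) (y : ℝ) (j : Fin 2) (s z : ℝ) :
    0 ≤ sojourn a γ y j s z := by
  unfold sojourn
  split_ifs
  · exact le_min (le_max_right _ _) (hitTime_nonneg _ _ _ _)
  · exact le_max_right _ _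
  · exact le_rfl

/-- This makes `y` absorbing for the recursion, in both states. -/
theorem sojourn_self {a γ : Fin 2 → ℝ} {y : ℝ} (hy : y < rho a γ 1) (j : Fin 2) (s : ℝ) :
    sojourn a γ y j s y = 0 := by
  unfold sojourn
  split_ifs with h1 h2
  · rw [hitTime_self hy, min_eq_right (le_max_right _ _)]
  · exact absurd h2 (lt_irrefl y)
  · rfl

/-- The level reached at the end of `sojourn`. -/
noncomputable def exitLevel (a γ : Fin 2 → ℝ) (y : ℝ) (j : Fin 2) (s z : ℝ) : ℝ :=
  flow (rho a γ j) (γ j) (sojourn a γ y j s z) z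

theorem exitLevel_self {a γ : Fin 2 → ℝ} {y : ℝ} (hy : y < rho a γ 1) (j : Fin 2) (s : ℝ) :
    exitLevel a γ y j s y = y := by
  rw [exitLevel, sojourn_self hy, flow_zero]

theorem measurable_sojourn (a γ : Fin 2 → ℝ) (y : ℝ) (j : Fin 2) :
    Measurable fun p : ℝ × ℝ => sojourn a γ y j p.1 p.2 := by
  unfold sojourn hitTime
  split_ifs
  · fun_prop
  · exact Measurable.ite (measurableSet_lt measurable_snd measurable_const) (by fun_prop)
      measurable_const

theorem measurable_exitLevel (a γ : Fin 2 → ℝ) (y : ℝ) (j : Fin 2) :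
    Measurable fun p : ℝ × ℝ => exitLevel a γ y j p.1 p.2 := by
  have := measurable_sojourn a γ y j
  unfold exitLevel flow
  fun_prop

/-- Both attraction levels lie above `m`. In state `0` the attraction level is at most `y`, and in
state `1` the sojourn is cut at the hitting time of `y`. -/
theorem exitLevel_mem {a γ : Fin 2 → ℝ} (hγ : ∀ i, 0 < γ i) {m y : ℝ} (hm : m ≤ rho a γ 0)
    (hy0 : rho a γ 0 ≤ y) (hy1 : y < rho a γ 1) (j : Fin 2) (s : ℝ) {z : ℝ}
    (hz : z ∈ Set.Icc m y) : exitLevel a γ y j s z ∈ Set.Icc m y := by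
  have hd := sojourn_nonneg a γ y j s z
  have hgd : 0 ≤ γ j * sojourn a γ y j s z := mul_nonneg (hγ j).le hd
  refine ⟨le_flow ?_ hz.1 hgd, ?_⟩
  · fin_cases j
    · exact hm
    · exact hm.trans (hy0.trans hy1.le)
  rcases hz.2.eq_or_lt with rfl | hzy
  · rw [exitLevel_self hy1]
  fin_cases j
  · exact (flow_lt_of_le hy0 hzy hgd).le
  · have h : sojourn a γ y 1 s z ≤ hitTime (rho a γ 1) (γ 1) y z := by
      simp only [sojourn, if_true]
      exact min_le_right _ _
    rcases h.eq_or_lt with h | h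
    · simp only [exitLevel, Fin.mk_one, h]
      exact (flow_hitTime (hγ 1) hz.2 hy1).le
    · exact (flow_lt_of_lt_hitTime (hγ 1) hz.2 hy1 h).le

end Flow

/-! ### The backward equations -/

section Backward

open Filter Topology

/-- The functions `u 0`, `u 1` solve the backward equations on `[m, y]`, with `u 1 y = 1`. -/
structure BackwardSystem (a γ lam : Fin 2 → ℝ) (q m y : ℝ) (u : Fin 2 → ℝ → ℝ) : Prop where
  gamma_pos : ∀ i, 0 < γ i
  lam_pos : ∀ i, 0 < lam i
  q_nonneg : 0 ≤ q
  le_rho_zero : m ≤ rho a γ 0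
  rho_zero_le : rho a γ 0 ≤ y
  lt_rho_one : y < rho a γ 1
  ode : ∀ j, ∀ z ∈ Set.Icc m y, ∃ u', HasDerivAt (u j) u' z ∧
    γ j * (rho a γ j - z) * u' = (q + lam j) * u j z - lam j * u (1 - j) z
  boundary : u 1 y = 1

/-- The value `u j z` for `z ∈ [m, y)`, and `1` elsewhere. -/
noncomputable def stopVal (u : Fin 2 → ℝ → ℝ) (m y : ℝ) (j : Fin 2) (z : ℝ) : ℝ :=
  open scoped Classical in (Set.Ico m y).piecewise (u j) (fun _ => 1) z

theorem stopVal_of_mem {u : Fin 2 → ℝ → ℝ} {m y z : ℝ} (j : Fin 2) (hz : z ∈ Set.Ico m y) :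
    stopVal u m y j z = u j z := Set.piecewise_eq_of_mem _ _ _ hz

/-- A path that hits `y` during a state-`1` holding time is recorded at the next switch as being at
`y` in state `0`. Its value must be `1` there, although `u 0 y` need not be. -/
theorem stopVal_self (u : Fin 2 → ℝ → ℝ) (m y : ℝ) (j : Fin 2) :
    stopVal u m y j y = 1 := Set.piecewise_eq_of_notMem _ _ _ (by simp)

theorem integral_expMeasure {r : ℝ} (hr : 0 < r) (f : ℝ → ℝ) :
    ∫ s, f s ∂(expMeasure r) = ∫ s in Set.Ioi 0, r * Real.exp (-(r * s)) * f s := by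
  have h1 : expMeasure r = volume.withDensity (exponentialPDF r) := rfl
  have hm : Measurable (exponentialPDF r) := (measurable_exponentialPDFReal r).ennreal_ofReal
  rw [h1, integral_withDensity_eq_integral_toReal_smul hm
    (ae_of_all _ fun s => ENNReal.ofReal_lt_top), ← integral_Ici_eq_integral_Ioi,
    ← integral_indicator measurableSet_Ici]
  refine integral_congr_ae (ae_of_all _ fun s => ?_)
  by_cases hs : 0 ≤ s
  · rw [Set.indicator_of_mem (Set.mem_Ici.2 hs)]
    simp only [smul_eq_mul]
    rw [exponentialPDF_of_nonneg hs, ENNReal.toReal_ofReal (by positivity)]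
  · rw [Set.indicator_of_notMem (by simpa using hs)]
    simp only [smul_eq_mul]
    rw [exponentialPDF_of_neg (not_le.1 hs), ENNReal.toReal_zero, zero_mul]

theorem integrableOn_of_integrable_expMeasure {r : ℝ} (hr : 0 < r) {f : ℝ → ℝ} (hf : Measurable f)
    {C : ℝ} (hC : ∀ s, |f s| ≤ C) :
    IntegrableOn (fun s => r * Real.exp (-(r * s)) * f s) (Set.Ioi 0) := by
  have h : IntegrableOn (fun s => r * Real.exp (-(r * s))) (Set.Ioi 0) := by
    have := (exp_neg_integrableOn_Ioi 0 hr).const_mul r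
    simp only [neg_mul] at this
    exact this
  exact h.mul_bdd hf.aestronglyMeasurable (ae_of_all _ fun s => by simpa using hC s)

variable {a γ lam : Fin 2 → ℝ} {q m y : ℝ} {u : Fin 2 → ℝ → ℝ}

theorem BackwardSystem.continuousOn (h : BackwardSystem a γ lam q m y u) (j : Fin 2) :
    ContinuousOn (u j) (Set.Icc m y) := fun z hz => by
  obtain ⟨u', hu, -⟩ := h.ode j z hz
  exact hu.continuousAt.continuousWithinAt

theorem BackwardSystem.measurable_stopVal (h : BackwardSystem a γ lam q m y u) (j : Fin 2) :
    Measurable (stopVal u m y j) := by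
  classical
  have := ((h.continuousOn j).mono Set.Ico_subset_Icc_self).measurable_piecewise
    (g := fun _ => (1 : ℝ)) continuousOn_const measurableSet_Ico
  convert this using 1
  funext z
  unfold stopVal
  congr

theorem BackwardSystem.exists_bound (h : BackwardSystem a γ lam q m y u) :
    ∃ C, ∀ j z, |stopVal u m y j z| ≤ C := by
  have hb : ∀ j, ∃ C, ∀ z, |stopVal u m y j z| ≤ C := by
    intro j
    obtain ⟨C, hC⟩ := isCompact_Icc.exists_bound_of_continuousOn (h.continuousOn j)
    refine ⟨max C 1, fun z => ?_⟩
    by_cases hz : z ∈ Set.Ico m y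
    · rw [stopVal_of_mem j hz]
      exact (hC z (Set.Ico_subset_Icc_self hz)).trans (le_max_left _ _)
    · rw [stopVal, Set.piecewise_eq_of_notMem _ _ _ hz, abs_one]
      exact le_max_right _ _
  choose C hC using hb
  exact ⟨max (C 0) (C 1), fun j z => (hC j z).trans (by fin_cases j <;> simp)⟩

/-- The factor `e^{-(q + λ j) s}` turns the backward equation along the flow into an antiderivative
of the first-switch integrand, so the one-step expectations reduce to boundary terms. -/
theorem BackwardSystem.hasDerivAt (h : BackwardSystem a γ lam q m y u) (j : Fin 2) {z s : ℝ}
    (hs : flow (rho a γ j) (γ j) s z ∈ Set.Icc m y) :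
    HasDerivAt (fun s => -(Real.exp (-((q + lam j) * s)) * u j (flow (rho a γ j) (γ j) s z)))
      (lam j * Real.exp (-(lam j * s)) *
        (Real.exp (-(q * s)) * u (1 - j) (flow (rho a γ j) (γ j) s z))) s := by
  obtain ⟨u', hu, hode⟩ := h.ode j _ hs
  have h1 : HasDerivAt (fun s : ℝ => -((q + lam j) * s)) (-(q + lam j)) s := by
    simpa using ((hasDerivAt_id s).const_mul (q + lam j)).fun_neg
  have h2 := HasDerivAt.comp s hu (hasDerivAt_flow (rho a γ j) (γ j) z s)
  refine (h1.exp.mul h2).neg.congr_deriv ?_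
  have h3 : Real.exp (-((q + lam j) * s)) = Real.exp (-(lam j * s)) * Real.exp (-(q * s)) := by
    rw [← Real.exp_add]; ring_nf
  simp only [Function.comp]
  rw [h3]
  linear_combination -(Real.exp (-(lam j * s)) * Real.exp (-(q * s))) * hode

/-- The discounted value at the end of a sojourn. -/
noncomputable def stepVal (a γ : Fin 2 → ℝ) (q m y : ℝ) (u : Fin 2 → ℝ → ℝ) (j : Fin 2)
    (s z : ℝ) : ℝ :=
  Real.exp (-(q * sojourn a γ y j s z)) * stopVal u m y (1 - j) (exitLevel a γ y j s z)

theorem BackwardSystem.measurable_stepVal (h : BackwardSystem a γ lam q m y u) (j : Fin 2) :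
    Measurable fun p : ℝ × ℝ => stepVal a γ q m y u j p.1 p.2 := by
  have h1 := measurable_sojourn a γ y j
  have h2 := (h.measurable_stopVal (1 - j)).comp (measurable_exitLevel a γ y j)
  unfold stepVal
  exact (Real.measurable_exp.comp (h1.const_mul q).neg).mul h2

theorem BackwardSystem.stepVal_le (h : BackwardSystem a γ lam q m y u) {C : ℝ}
    (hC : ∀ j z, |stopVal u m y j z| ≤ C) (j : Fin 2) (s z : ℝ) :
    |stepVal a γ q m y u j s z| ≤ C := by
  rw [stepVal, abs_mul, Real.abs_exp]
  have h1 : Real.exp (-(q * sojourn a γ y j s z)) ≤ 1 :=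
    Real.exp_le_one_iff.2 (by have := mul_nonneg h.q_nonneg (sojourn_nonneg a γ y j s z); linarith)
  calc _ ≤ 1 * C := mul_le_mul h1 (hC _ _) (abs_nonneg _) zero_le_one
    _ = C := one_mul C

/-- In state `0` the flow stays below `y` forever, so every switch occurs before passage; the
boundary term at infinity vanishes because `u 0` is bounded on `[m, y)` and `q + λ₀ > 0`. -/
theorem BackwardSystem.integral_stepVal_zero (h : BackwardSystem a γ lam q m y u) {z : ℝ}
    (hz : z ∈ Set.Ico m y) :
    ∫ s, stepVal a γ q m y u 0 s z ∂(expMeasure (lam 0)) = u 0 z := by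
  obtain ⟨C, hC⟩ := h.exists_bound
  have hmem : ∀ s : ℝ, 0 ≤ s → flow (rho a γ 0) (γ 0) s z ∈ Set.Ico m y := fun s hs =>
    have := mul_nonneg (h.gamma_pos 0).le hs
    ⟨le_flow h.le_rho_zero hz.1 this, flow_lt_of_le h.rho_zero_le hz.2 this⟩
  have hval : ∀ s : ℝ, 0 ≤ s → stepVal a γ q m y u 0 s z =
      Real.exp (-(q * s)) * u (1 - 0) (flow (rho a γ 0) (γ 0) s z) := by
    intro s hs
    have hd : sojourn a γ y 0 s z = s := by simp [sojourn, hz.2, hs]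
    rw [stepVal, exitLevel, hd, stopVal_of_mem _ (hmem s hs)]
  have hint := integrableOn_of_integrable_expMeasure (h.lam_pos 0)
    ((h.measurable_stepVal 0).comp (measurable_id.prodMk measurable_const))
    (fun s => h.stepVal_le hC 0 s z)
  rw [integral_expMeasure (h.lam_pos 0)]
  have hl : Tendsto (fun s => -(Real.exp (-((q + lam 0) * s)) *
      u 0 (flow (rho a γ 0) (γ 0) s z))) atTop (𝓝 0) := by
    have hql : 0 < q + lam 0 := by have := h.q_nonneg; have := h.lam_pos 0; linarith
    have h1 : Tendsto (fun s : ℝ => Real.exp (-((q + lam 0) * s))) atTop (𝓝 0) :=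
      Real.tendsto_exp_neg_atTop_nhds_zero.comp (tendsto_id.const_mul_atTop hql)
    have h2 : Tendsto (fun s : ℝ => Real.exp (-((q + lam 0) * s)) * C) atTop (𝓝 0) := by
      simpa using h1.mul_const C
    refine squeeze_zero_norm' ?_ h2
    filter_upwards [eventually_ge_atTop 0] with s hs
    rw [norm_neg, norm_mul, Real.norm_eq_abs, Real.abs_exp, Real.norm_eq_abs]
    have := hC 0 (flow (rho a γ 0) (γ 0) s z)
    rw [stopVal_of_mem _ (hmem s hs)] at this
    gcongr
  have hcongr : Set.EqOn (fun s => lam 0 * Real.exp (-(lam 0 * s)) * stepVal a γ q m y u 0 s z)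
      (fun s => lam 0 * Real.exp (-(lam 0 * s)) *
        (Real.exp (-(q * s)) * u (1 - 0) (flow (rho a γ 0) (γ 0) s z))) (Set.Ioi 0) :=
    fun s hs => by simp only [hval s (le_of_lt hs)]
  rw [setIntegral_congr_fun measurableSet_Ioi hcongr, integral_Ioi_of_hasDerivAt_of_tendsto'
    (fun s hs => h.hasDerivAt 0 (Set.Ico_subset_Icc_self (hmem s hs)))
    (hint.congr_fun hcongr measurableSet_Ioi) hl]
  simp [flow_zero]

/-- The integral splits at the hitting time `τ`. Holding times beyond `τ` contribute `e^{-(q + λ₁)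
τ}`, which cancels the boundary term at `τ` exactly because `u 1 y = 1`. -/
theorem BackwardSystem.integral_stepVal_one (h : BackwardSystem a γ lam q m y u) {z : ℝ}
    (hz : z ∈ Set.Ico m y) :
    ∫ s, stepVal a γ q m y u 1 s z ∂(expMeasure (lam 1)) = u 1 z := by
  obtain ⟨C, hC⟩ := h.exists_bound
  have hl1 := h.lam_pos 1
  have hlt := h.lt_rho_one
  have hm1 : m ≤ rho a γ 1 := h.le_rho_zero.trans (h.rho_zero_le.trans hlt.le)
  set τ := hitTime (rho a γ 1) (γ 1) y z with hτ
  have hτ0 : 0 ≤ τ := hitTime_nonneg _ _ _ _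
  have hflowτ : flow (rho a γ 1) (γ 1) τ z = y := flow_hitTime (h.gamma_pos 1) hz.2.le hlt
  have hmem : ∀ s : ℝ, 0 ≤ s → s < τ → flow (rho a γ 1) (γ 1) s z ∈ Set.Ico m y := fun s hs hs' =>
    ⟨le_flow hm1 hz.1 (mul_nonneg (h.gamma_pos 1).le hs),
      flow_lt_of_lt_hitTime (h.gamma_pos 1) hz.2.le hlt hs'⟩
  have hmem' : ∀ s ∈ Set.uIcc 0 τ, flow (rho a γ 1) (γ 1) s z ∈ Set.Icc m y := by
    intro s hs
    rw [Set.uIcc_of_le hτ0] at hs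
    rcases hs.2.eq_or_lt with rfl | h'
    · rw [hflowτ]; exact ⟨hz.1.trans hz.2.le, le_rfl⟩
    · exact Set.Ico_subset_Icc_self (hmem s hs.1 h')
  have hint := integrableOn_of_integrable_expMeasure hl1
    ((h.measurable_stepVal 1).comp (measurable_id.prodMk measurable_const))
    (fun s => h.stepVal_le hC 1 s z)
  simp only [Function.comp, id] at hint
  rw [integral_expMeasure hl1, ← Set.Ioc_union_Ioi_eq_Ioi hτ0, setIntegral_union
    (Set.Ioc_disjoint_Ioi le_rfl) measurableSet_Ioi (hint.mono_set Set.Ioc_subset_Ioi_self)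
    (hint.mono_set (Set.Ioi_subset_Ioi hτ0))]
  -- The endpoint `τ` is left out: there `stopVal` is `1` while the right side involves `u 0 y`.
  have hcongr : Set.EqOn (fun s => lam 1 * Real.exp (-(lam 1 * s)) * stepVal a γ q m y u 1 s z)
      (fun s => lam 1 * Real.exp (-(lam 1 * s)) *
        (Real.exp (-(q * s)) * u (1 - 1) (flow (rho a γ 1) (γ 1) s z))) (Set.Ioo 0 τ) := by
    intro s hs
    have hd : sojourn a γ y 1 s z = s := by simp [sojourn, hs.1.le, ← hτ, hs.2.le]
    simp only
    rw [stepVal, exitLevel, hd, stopVal_of_mem _ (hmem s hs.1.le hs.2)]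
  have hcongr' : Set.EqOn (fun s => lam 1 * Real.exp (-(lam 1 * s)) * stepVal a γ q m y u 1 s z)
      (fun s => (lam 1 * Real.exp (-(q * τ))) * Real.exp (-lam 1 * s)) (Set.Ioi τ) := by
    intro s hs
    have hs' : τ < s := hs
    have hd : sojourn a γ y 1 s z = τ := by
      simp [sojourn, ← hτ, hs'.le]
    simp only
    rw [stepVal, exitLevel, hd, hflowτ, stopVal_self, neg_mul]
    ring
  have hii : IntervalIntegrable (fun s => lam 1 * Real.exp (-(lam 1 * s)) *
        (Real.exp (-(q * s)) * u (1 - 1) (flow (rho a γ 1) (γ 1) s z))) volume 0 τ := by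
    refine ContinuousOn.intervalIntegrable ?_
    have h1 : ContinuousOn (fun s => u (1 - 1) (flow (rho a γ 1) (γ 1) s z)) (Set.uIcc 0 τ) :=
      (h.continuousOn (1 - 1)).comp (fun s _ =>
        (hasDerivAt_flow _ _ z s).continuousAt.continuousWithinAt) hmem'
    exact (Continuous.continuousOn (by fun_prop)).mul
      ((Continuous.continuousOn (by fun_prop)).mul h1)
  rw [integral_Ioc_eq_integral_Ioo, setIntegral_congr_fun measurableSet_Ioo hcongr,
    setIntegral_congr_fun measurableSet_Ioi hcongr', ← integral_Ioc_eq_integral_Ioo,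
    ← intervalIntegral.integral_of_le hτ0, intervalIntegral.integral_eq_sub_of_hasDerivAt
      (fun s hs => h.hasDerivAt 1 (hmem' s hs)) hii, integral_const_mul,
    integral_exp_mul_Ioi (by linarith), hflowτ, h.boundary, flow_zero,
    show -((q + lam 1) * τ) = -(q * τ) + -lam 1 * τ by ring, Real.exp_add]
  simp only [mul_zero, neg_zero, Real.exp_zero]
  field_simp
  ring

theorem BackwardSystem.integral_stepVal (h : BackwardSystem a γ lam q m y u) (j : Fin 2) {z : ℝ}
    (hz : z ∈ Set.Icc m y) :
    ∫ s, stepVal a γ q m y u j s z ∂(expMeasure (lam j)) = stopVal u m y j z := by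
  rcases hz.2.eq_or_lt with rfl | hzy
  · have : ∀ s, stepVal a γ q m z u j s z = 1 := fun s => by
      rw [stepVal, exitLevel_self h.lt_rho_one, sojourn_self h.lt_rho_one, stopVal_self]
      simp
    have := isProbabilityMeasure_expMeasure (h.lam_pos j)
    simp [*, stopVal_self]
  · rw [stopVal_of_mem j ⟨hz.1, hzy⟩]
    fin_cases j
    · exact h.integral_stepVal_zero ⟨hz.1, hzy⟩
    · exact h.integral_stepVal_one ⟨hz.1, hzy⟩

end Backward

/-! ### The stopped path at the switching times -/

section Skeleton

open Filter Topology

/-- The pair `(min T J, X (min T J))` at the `n`-th switching time `J`, as a function of the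
holding times `s`, where `T` is the first passage time through `y` of the path from `x`. -/
noncomputable def skeleton (a γ : Fin 2 → ℝ) (y : ℝ) (i : Fin 2) (x : ℝ) (s : ℕ → ℝ) : ℕ → ℝ × ℝ
  | 0 => (0, x)
  | n + 1 =>
    ((skeleton a γ y i x s n).1 +
      sojourn a γ y (stateAfter i n) (s n) (skeleton a γ y i x s n).2,
      exitLevel a γ y (stateAfter i n) (s n) (skeleton a γ y i x s n).2)

theorem skeleton_fst_nonneg (a γ : Fin 2 → ℝ) (y : ℝ) (i : Fin 2) (x : ℝ) (s : ℕ → ℝ) (n : ℕ) :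
    0 ≤ (skeleton a γ y i x s n).1 := by
  induction n with
  | zero => exact le_rfl
  | succ n ih => exact add_nonneg ih (sojourn_nonneg _ _ _ _ _ _)

theorem skeleton_snd_mem {a γ : Fin 2 → ℝ} (hγ : ∀ i, 0 < γ i) {m y : ℝ} (hm : m ≤ rho a γ 0)
    (hy0 : rho a γ 0 ≤ y) (hy1 : y < rho a γ 1) (i : Fin 2) {x : ℝ} (hx : x ∈ Set.Icc m y)
    (s : ℕ → ℝ) (n : ℕ) : (skeleton a γ y i x s n).2 ∈ Set.Icc m y := by
  induction n with
  | zero => exact hx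
  | succ n ih => exact exitLevel_mem hγ hm hy0 hy1 _ _ ih

theorem skeleton_congr (a γ : Fin 2 → ℝ) (y : ℝ) (i : Fin 2) (x : ℝ) {s s' : ℕ → ℝ} {n : ℕ}
    (h : ∀ k < n, s k = s' k) : skeleton a γ y i x s n = skeleton a γ y i x s' n := by
  induction n with
  | zero => rfl
  | succ n ih => rw [skeleton, skeleton, ih fun k hk => h k (by lia), h n (by lia)]

theorem measurable_skeleton (a γ : Fin 2 → ℝ) (y : ℝ) (i : Fin 2) (x : ℝ) (n : ℕ) :
    Measurable fun s : ℕ → ℝ => skeleton a γ y i x s n := by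
  induction n with
  | zero => exact measurable_const
  | succ n ih =>
    have h : Measurable fun s : ℕ → ℝ => (s n, (skeleton a γ y i x s n).2) :=
      (measurable_pi_apply n).prodMk ih.snd
    exact (ih.fst.add ((measurable_sojourn a γ y (stateAfter i n)).comp h)).prodMk
      ((measurable_exitLevel a γ y (stateAfter i n)).comp h)

/-- Once the state `1` lasts longer than the flow needs from `m` to `y`, the path has reached `y`. -/
theorem skeleton_succ_snd_eq {a γ : Fin 2 → ℝ} (hγ : ∀ i, 0 < γ i) {m y : ℝ}
    (hm : m ≤ rho a γ 0) (hy0 : rho a γ 0 ≤ y) (hy1 : y < rho a γ 1) {i : Fin 2} {x : ℝ}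
    (hx : x ∈ Set.Icc m y) {s : ℕ → ℝ} {n : ℕ} (hn : stateAfter i n = 1)
    (hs : hitTime (rho a γ 1) (γ 1) y m ≤ s n) : (skeleton a γ y i x s (n + 1)).2 = y := by
  have hZ := skeleton_snd_mem hγ hm hy0 hy1 i hx s n
  have h1 := hitTime_antitone (hγ 1) hZ.1 hZ.2 hy1
  have hd : sojourn a γ y 1 (s n) (skeleton a γ y i x s n).2 =
      hitTime (rho a γ 1) (γ 1) y (skeleton a γ y i x s n).2 := by
    rw [sojourn, if_pos rfl]
    exact min_eq_right ((h1.trans hs).trans (le_max_left _ _))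
  rw [skeleton, hn]
  simp only
  rw [exitLevel, hd, flow_hitTime (hγ 1) hZ.2 hy1]

theorem skeleton_succ_of_snd_eq {a γ : Fin 2 → ℝ} {y : ℝ} (hy1 : y < rho a γ 1) {i : Fin 2} {x : ℝ}
    {s : ℕ → ℝ} {n : ℕ} (hn : (skeleton a γ y i x s n).2 = y) :
    skeleton a γ y i x s (n + 1) = skeleton a γ y i x s n := by
  refine Prod.ext ?_ ?_
  · simp only [skeleton]
    rw [hn, sojourn_self hy1, add_zero]
  · simp only [skeleton]
    rw [hn, exitLevel_self hy1]

theorem skeleton_eq_of_le {a γ : Fin 2 → ℝ} {y : ℝ} (hy1 : y < rho a γ 1) {i : Fin 2} {x : ℝ}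
    {s : ℕ → ℝ} {n k : ℕ} (hn : (skeleton a γ y i x s n).2 = y) (hk : n ≤ k) :
    skeleton a γ y i x s k = skeleton a γ y i x s n := by
  induction k, hk using Nat.le_induction with
  | base => rfl
  | succ k _ ih => rw [skeleton_succ_of_snd_eq hy1 (by rw [ih, hn]), ih]

end Skeleton

/-! ### Paths of the process -/

section Path

open Filter Topology

variable {a γ : Fin 2 → ℝ} {i : Fin 2} {s : ℕ → ℝ} {ε : ℝ → Fin 2} {x : ℝ} {X : ℝ → ℝ}

/-- On the interior of each holding interval the drift agrees with a function continuous up to the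
endpoints. Integrability is needed to differentiate the integral equation. -/
theorem intervalIntegrable_drift (hs : ∀ n, 0 < s n)
    (hε : ∀ (n : ℕ) (t : ℝ), ∑ k ∈ Finset.range n, s k ≤ t →
      t < ∑ k ∈ Finset.range (n + 1), s k → ε t = stateAfter i n)
    (hXc : ContinuousOn X (Set.Ici 0)) (n : ℕ) :
    IntervalIntegrable (fun t => a (ε t) - γ (ε t) * X t) volume 0
      (∑ k ∈ Finset.range n, s k) := by
  induction n with
  | zero => simp
  | succ n ih =>
    have hJ : 0 ≤ ∑ k ∈ Finset.range n, s k := Finset.sum_nonneg fun k _ => (hs k).le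
    have hJJ : ∑ k ∈ Finset.range n, s k ≤ ∑ k ∈ Finset.range (n + 1), s k := by
      rw [Finset.sum_range_succ]; linarith [hs n]
    refine ih.trans ?_
    have hc : ContinuousOn (fun t => a (stateAfter i n) - γ (stateAfter i n) * X t)
        (Set.uIcc (∑ k ∈ Finset.range n, s k) (∑ k ∈ Finset.range (n + 1), s k)) := by
      have : ContinuousOn X
          (Set.uIcc (∑ k ∈ Finset.range n, s k) (∑ k ∈ Finset.range (n + 1), s k)) :=
        hXc.mono fun t ht => by rw [Set.uIcc_of_le hJJ] at ht; exact hJ.trans ht.1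
      fun_prop
    refine hc.intervalIntegrable.congr_uIoo fun t ht => ?_
    rw [Set.uIoo_of_le hJJ] at ht
    simp only [hε n t ht.1.le ht.2]

/-- Since `ε` is only right-continuous, the integral equation is differentiated from the right; `(X
- ρ) e^{γ (r - J)}` then has zero right derivative and is constant. -/
theorem path_eq_flow (hγ : ∀ i, 0 < γ i) (hs : ∀ n, 0 < s n)
    (hε : ∀ (n : ℕ) (t : ℝ), ∑ k ∈ Finset.range n, s k ≤ t →
      t < ∑ k ∈ Finset.range (n + 1), s k → ε t = stateAfter i n)
    (hXc : ContinuousOn X (Set.Ici 0))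
    (hX : ∀ t : ℝ, 0 ≤ t → X t = x + ∫ r in (0 : ℝ)..t, (a (ε r) - γ (ε r) * X r))
    (n : ℕ) {t : ℝ} (ht : t ∈ Set.Icc 0 (s n)) :
    X (∑ k ∈ Finset.range n, s k + t) =
      flow (rho a γ (stateAfter i n)) (γ (stateAfter i n)) t (X (∑ k ∈ Finset.range n, s k)) := by
  have hJ : 0 ≤ ∑ k ∈ Finset.range n, s k := Finset.sum_nonneg fun k _ => (hs k).le
  have hint := intervalIntegrable_drift (a := a) (γ := γ) hs hε hXc (n + 1)
  have hεn := hε n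
  rw [Finset.sum_range_succ] at hint hεn
  set J := ∑ k ∈ Finset.range n, s k with hJdef
  set j := stateAfter i n
  set ρ := rho a γ j with hρ
  have haρ : a j = γ j * ρ := by rw [hρ, rho, mul_div_cancel₀ _ (hγ j).ne']
  have hderiv : ∀ r ∈ Set.Ico J (J + s n), HasDerivWithinAt X (γ j * (ρ - X r)) (Set.Ici r) r := by
    intro r hr
    have hr0 : 0 ≤ r := hJ.trans hr.1
    have hJs : 0 ≤ J + s n := hr0.trans hr.2.le
    have hIoo : Set.Ioo r (J + s n) ∈ 𝓝[>] r := Ioo_mem_nhdsGT hr.2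
    have hval : a (ε r) - γ (ε r) * X r = γ j * (ρ - X r) := by
      rw [hεn r hr.1 hr.2, haρ]; ring
    have hmeas : StronglyMeasurableAtFilter (fun r => a (ε r) - γ (ε r) * X r) (𝓝[>] r) volume :=
      ⟨Set.Ioc 0 (J + s n), mem_of_superset hIoo fun t ht => ⟨hr0.trans_lt ht.1, ht.2.le⟩,
        hint.1.aestronglyMeasurable⟩
    have hcont : ContinuousWithinAt (fun r => a (ε r) - γ (ε r) * X r) (Set.Ioi r) r := by
      have hXr : ContinuousWithinAt X (Set.Ioi r) r :=
        (hXc r hr0).mono fun t ht => hr0.trans (le_of_lt ht)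
      have hg : ContinuousWithinAt (fun t => a j - γ j * X t) (Set.Ioi r) r := by fun_prop
      refine hg.congr_of_eventuallyEq ?_ ?_
      · filter_upwards [hIoo] with t ht
        rw [hεn t (hr.1.trans ht.1.le) ht.2]
      · simp only [hεn r hr.1 hr.2]
    have hd := intervalIntegral.integral_hasDerivWithinAt_right (s := Set.Ici r)
      (hint.mono_set (by
        rw [Set.uIcc_of_le hr0, Set.uIcc_of_le hJs]
        exact Set.Icc_subset_Icc_right hr.2.le)) hmeas hcont
    rw [hval] at hd
    exact (hd.const_add x).congr (fun t ht => hX t (hr0.trans ht)) (hX r hr0)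
  have hconst := constant_of_has_deriv_right_zero
    (f := fun r => (X r - ρ) * Real.exp (γ j * (r - J))) (a := J) (b := J + s n) ?_ ?_ (J + t)
    ⟨by linarith [ht.1], by linarith [ht.2]⟩
  · simp only [add_sub_cancel_left, sub_self, mul_zero, Real.exp_zero, mul_one] at hconst
    rw [flow, ← hconst, mul_assoc, ← Real.exp_add, add_neg_cancel, Real.exp_zero]
    ring
  · have : ContinuousOn X (Set.Icc J (J + s n)) := hXc.mono fun r hr => hJ.trans hr.1
    fun_prop
  · intro r hr
    have h1 : HasDerivWithinAt (fun r => Real.exp (γ j * (r - J)))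
        (Real.exp (γ j * (r - J)) * γ j) (Set.Ici r) r := by
      have := ((((hasDerivAt_id r).sub_const J).const_mul (γ j)).exp).hasDerivWithinAt
        (s := Set.Ici r)
      simpa using this
    refine (((hderiv r hr).sub_const ρ).mul h1).congr_deriv ?_
    ring

/-- This identifies the recursion with the process: the first alternative is "not yet at `y`", and
in the second the first coordinate is the passage time. -/
theorem skeleton_dichotomy (hγ : ∀ i, 0 < γ i) {y : ℝ} (hy0 : rho a γ 0 ≤ y) (hy1 : y < rho a γ 1)
    (hxy : x < y) (hs : ∀ n, 0 < s n)
    (hε : ∀ (n : ℕ) (t : ℝ), ∑ k ∈ Finset.range n, s k ≤ t →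
      t < ∑ k ∈ Finset.range (n + 1), s k → ε t = stateAfter i n)
    (hXc : ContinuousOn X (Set.Ici 0))
    (hX : ∀ t : ℝ, 0 ≤ t → X t = x + ∫ r in (0 : ℝ)..t, (a (ε r) - γ (ε r) * X r)) (n : ℕ) :
    ((skeleton a γ y i x s n).2 < y ∧ (skeleton a γ y i x s n).1 = ∑ k ∈ Finset.range n, s k ∧
      X (∑ k ∈ Finset.range n, s k) = (skeleton a γ y i x s n).2 ∧
      ∀ t ∈ Set.Icc 0 (∑ k ∈ Finset.range n, s k), X t < y) ∨
    ((skeleton a γ y i x s n).2 = y ∧ X (skeleton a γ y i x s n).1 = y ∧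
      ∀ t ∈ Set.Ico 0 (skeleton a γ y i x s n).1, X t < y) := by
  have hX0 : X 0 = x := by simpa using hX 0 le_rfl
  induction n with
  | zero =>
    left
    refine ⟨hxy, by simp [skeleton], by simpa [skeleton] using hX0, fun t ht => ?_⟩
    simp only [Finset.range_zero, Finset.sum_empty, Set.Icc_self, Set.mem_singleton_iff] at ht
    rw [ht, hX0]
    exact hxy
  | succ n ih =>
    rcases ih with ⟨hZ, hθ, hXJ, hlt⟩ | h
    swap
    · right
      rwa [skeleton_succ_of_snd_eq hy1 h.1]
    have hflow := fun t ht => path_eq_flow (a := a) (γ := γ) hγ hs hε hXc hX n (t := t) ht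
    set Z := (skeleton a γ y i x s n).2
    set J := ∑ k ∈ Finset.range n, s k
    rw [hXJ] at hflow
    have hsn := hs n
    -- A deterministic alternative for one holding interval; only state `1` can realise the second
    -- case.
    have key : (sojourn a γ y (stateAfter i n) (s n) Z = s n ∧ ∀ r ∈ Set.Icc 0 (s n),
        flow (rho a γ (stateAfter i n)) (γ (stateAfter i n)) r Z < y) ∨
        (sojourn a γ y (stateAfter i n) (s n) Z ≤ s n ∧
          flow (rho a γ (stateAfter i n)) (γ (stateAfter i n))
            (sojourn a γ y (stateAfter i n) (s n) Z) Z = y ∧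
          ∀ r ∈ Set.Ico 0 (sojourn a γ y (stateAfter i n) (s n) Z),
            flow (rho a γ (stateAfter i n)) (γ (stateAfter i n)) r Z < y) := by
      generalize stateAfter i n = j
      by_cases hj : j = 1
      · subst hj
        simp only [sojourn, if_true, max_eq_left hsn.le]
        rcases lt_or_ge (s n) (hitTime (rho a γ 1) (γ 1) y Z) with h | h
        · left
          exact ⟨min_eq_left h.le, fun r hr =>
            flow_lt_of_lt_hitTime (hγ 1) hZ.le hy1 (hr.2.trans_lt h)⟩
        · right
          rw [min_eq_right h]
          exact ⟨h, flow_hitTime (hγ 1) hZ.le hy1, fun r hr =>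
            flow_lt_of_lt_hitTime (hγ 1) hZ.le hy1 hr.2⟩
      · left
        obtain rfl : j = 0 := by lia
        refine ⟨by simp [sojourn, hZ, hsn.le], fun r hr =>
          flow_lt_of_le hy0 hZ (mul_nonneg (hγ 0).le hr.1)⟩
    have hbelow : ∀ t, 0 ≤ t → t ≤ J + s n → (0 ≤ t - J →
        flow (rho a γ (stateAfter i n)) (γ (stateAfter i n)) (t - J) Z < y) → X t < y := by
      intro t ht0 ht hr
      rcases le_or_gt t J with htJ | htJ
      · exact hlt t ⟨ht0, htJ⟩
      · have := hflow (t - J) ⟨by linarith, by linarith⟩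
        rw [add_sub_cancel] at this
        rw [this]
        exact hr (by linarith)
    rcases key with ⟨hd, hr⟩ | ⟨hd, hy, hr⟩
    · left
      have h1 : (skeleton a γ y i x s (n + 1)).2 =
          flow (rho a γ (stateAfter i n)) (γ (stateAfter i n)) (s n) Z := by
        rw [skeleton, exitLevel, hd]
      rw [h1, Finset.sum_range_succ]
      refine ⟨hr _ ⟨hsn.le, le_rfl⟩, ?_, hflow _ ⟨hsn.le, le_rfl⟩, fun t ht => ?_⟩
      · rw [skeleton, hd, hθ]
      · exact hbelow t ht.1 (by linarith [ht.2]) fun h => hr _ ⟨h, by linarith [ht.2]⟩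
    · right
      have hd0 := sojourn_nonneg a γ y (stateAfter i n) (s n) Z
      have h1 : (skeleton a γ y i x s (n + 1)).1 =
          J + sojourn a γ y (stateAfter i n) (s n) Z := by
        rw [skeleton, hθ]
      rw [h1]
      refine ⟨hy, by rw [hflow _ ⟨hd0, hd⟩, hy], fun t ht => ?_⟩
      exact hbelow t ht.1 (by linarith [ht.2]) fun h => hr _ ⟨h, by linarith [ht.2]⟩

end Path

theorem passageTime_eq_ofReal {Ω : Type*} {X : ℝ → Ω → ℝ} {y θ : ℝ} {ω : Ω} (hθ : 0 < θ)
    (h : X θ ω = y) (hlt : ∀ t ∈ Set.Ico 0 θ, X t ω < y) :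
    passageTime X y ω = ENNReal.ofReal θ := by
  refine IsLeast.csInf_eq ⟨⟨θ, ⟨hθ, h⟩, rfl⟩, ?_⟩
  rintro _ ⟨t, ⟨ht0, ht⟩, rfl⟩
  refine ENNReal.ofReal_le_ofReal (le_of_not_gt fun hlt' => ?_)
  exact (hlt t ⟨ht0.le, hlt'⟩).ne ht

/-! ### The holding times -/

section HoldingTimes

open Filter Topology

theorem stateAfter_zero (i : Fin 2) : stateAfter i 0 = i := by simp [stateAfter]

theorem stateAfter_succ (i : Fin 2) (n : ℕ) : stateAfter i (n + 1) = 1 - stateAfter i n := by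
  unfold stateAfter
  by_cases h : Even n
  · rw [if_pos h, if_neg (by simpa [Nat.even_add_one] using h)]
  · rw [if_neg h, if_pos (by simpa [Nat.even_add_one] using h), sub_sub_cancel]

theorem stateAfter_two_mul (i : Fin 2) (k : ℕ) : stateAfter i (2 * k) = i := by
  simp [stateAfter]

theorem exists_injective_stateAfter_eq_one (i : Fin 2) :
    ∃ g : ℕ → ℕ, g.Injective ∧ ∀ k, stateAfter i (g k) = 1 := by
  by_cases hi : i = 1
  · exact ⟨fun k => 2 * k, fun k l h => by simpa using h, fun k => by
      rw [stateAfter_two_mul, hi]⟩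
  · obtain rfl : i = 0 := by lia
    exact ⟨fun k => 2 * k + 1, fun k l h => by simpa using h, fun k => by
      rw [stateAfter_succ, stateAfter_two_mul]; rfl⟩

variable {Ω : Type*} [MeasurableSpace Ω] {μ : Measure Ω}

theorem real_expMeasure_Iic {r : ℝ} (hr : 0 < r) {x : ℝ} (hx : 0 ≤ x) :
    (expMeasure r).real (Set.Iic x) = 1 - Real.exp (-(r * x)) := by
  have := isProbabilityMeasure_expMeasure hr
  rw [← cdf_eq_real, cdf_expMeasure_eq hr, if_pos hx]

theorem ae_pos_of_map_eq_expMeasure {S : Ω → ℝ} (hS : Measurable S) {r : ℝ} (hr : 0 < r)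
    (h : μ.map S = expMeasure r) : ∀ᵐ ω ∂μ, 0 < S ω := by
  have := isProbabilityMeasure_expMeasure hr
  have h0 : (expMeasure r) (Set.Iic 0) = 0 := by
    have := real_expMeasure_Iic hr le_rfl
    simpa [Measure.real, ENNReal.toReal_eq_zero_iff] using this
  rw [← h, Measure.map_apply hS measurableSet_Iic] at h0
  rw [ae_iff]
  convert h0 using 2
  ext ω
  simp

/-- The first `N` variables all stay at or below `c` with probability `p ^ N`, where `p < 1`. -/
theorem ae_exists_le_of_iIndepFun {S : ℕ → Ω → ℝ} (hS : ∀ n, Measurable (S n))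
    (hind : iIndepFun S μ) {r : ℝ} (hr : 0 < r) (hmap : ∀ n, μ.map (S n) = expMeasure r)
    {c : ℝ} (hc : 0 ≤ c) : ∀ᵐ ω ∂μ, ∃ n, c ≤ S n ω := by
  have := isProbabilityMeasure_expMeasure hr
  set p := (expMeasure r) (Set.Iic c) with hp
  have hp1 : p < 1 := by
    rw [hp, ← ENNReal.ofReal_toReal (measure_ne_top (expMeasure r) (Set.Iic c)), ← Measure.real,
      real_expMeasure_Iic hr hc, ENNReal.ofReal_lt_one]
    linarith [Real.exp_pos (-(r * c))]
  have hN : ∀ N : ℕ, μ {ω | ¬ ∃ n, c ≤ S n ω} ≤ p ^ N := by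
    intro N
    have h1 := hind.meas_biInter (S := Finset.range N) (s := fun n => S n ⁻¹' Set.Iic c)
      fun n _ => ⟨_, measurableSet_Iic, rfl⟩
    have h2 : ∀ n ∈ Finset.range N, μ (S n ⁻¹' Set.Iic c) = p := fun n _ => by
      rw [← Measure.map_apply (hS n) measurableSet_Iic, hmap n]
    rw [Finset.prod_congr rfl h2, Finset.prod_const, Finset.card_range] at h1
    rw [← h1]
    refine measure_mono fun ω hω => ?_
    simp only [Set.mem_ofPred_eq, not_exists, not_le] at hω
    simp only [Set.mem_iInter]
    exact fun n _ => (hω n).le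
  rw [ae_iff]
  exact le_antisymm (ge_of_tendsto' (ENNReal.tendsto_pow_atTop_nhds_zero_of_lt_one hp1) hN)
    zero_le

theorem indepFun_skeleton (a γ : Fin 2 → ℝ) (y : ℝ) (i : Fin 2) (x : ℝ) {S : ℕ → Ω → ℝ}
    (hS : ∀ n, Measurable (S n)) (hind : iIndepFun S μ) (n : ℕ) :
    IndepFun (fun ω => skeleton a γ y i x (fun k => S k ω) n) (S n) μ := by
  have h := hind.indepFun_finset (Finset.range n) {n} (by simp) hS
  -- Padding with zeros is harmless, since `skeleton` at `n` sees only the first `n` holding times.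
  set ext : (Finset.range n → ℝ) → ℕ → ℝ := fun t k =>
    if hk : k ∈ Finset.range n then t ⟨k, hk⟩ else 0 with hext
  have hm : Measurable ext := by
    refine measurable_pi_lambda _ fun k => ?_
    simp only [hext]
    split_ifs
    · exact measurable_pi_apply _
    · exact measurable_const
  have h2 := h.comp ((measurable_skeleton a γ y i x n).comp hm)
    (measurable_pi_apply (⟨n, by simp⟩ : ({n} : Finset ℕ)))
  refine h2.congr (ae_of_all _ fun ω => ?_) (ae_of_all _ fun ω => rfl)
  symm
  refine skeleton_congr a γ y i x fun k hk => ?_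
  simp [hext, hk]

variable [IsProbabilityMeasure μ]

/-- Independence makes the joint law a product, and Fubini then integrates `S` out with `V` frozen;
this replaces conditional expectations. -/
theorem integral_comp_prod_of_indepFun {α : Type*} [MeasurableSpace α] {V : Ω → α} {S : Ω → ℝ}
    (hV : Measurable V) (hS : Measurable S) (hVS : IndepFun V S μ) {f : α × ℝ → ℝ}
    (hf : Measurable f) (hint : Integrable (fun ω => f (V ω, S ω)) μ) :
    ∫ ω, f (V ω, S ω) ∂μ = ∫ ω, ∫ s, f (V ω, s) ∂(μ.map S) ∂μ := by
  have : IsProbabilityMeasure (μ.map S) := Measure.isProbabilityMeasure_map hS.aemeasurable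
  have : IsProbabilityMeasure (μ.map V) := Measure.isProbabilityMeasure_map hV.aemeasurable
  have hprod := hVS.map_prod_eq_prod_map_map hV.aemeasurable hS.aemeasurable
  have hVSm : Measurable fun ω => (V ω, S ω) := hV.prodMk hS
  have hint' : Integrable f ((μ.map V).prod (μ.map S)) := by
    rw [← hprod, integrable_map_measure hf.aestronglyMeasurable hVSm.aemeasurable]
    exact hint
  rw [← integral_map hVSm.aemeasurable (f := f) hf.aestronglyMeasurable, hprod,
    integral_prod f hint', integral_map hV.aemeasurable]
  exact hf.stronglyMeasurable.integral_prod_right'.aestronglyMeasurable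

end HoldingTimes

/-! ### The optional stopping argument -/

section Stopping

open Filter Topology

variable {Ω : Type*} [MeasurableSpace Ω] {μ : Measure Ω} [IsProbabilityMeasure μ]
  {a γ lam : Fin 2 → ℝ} {q m y : ℝ} {u : Fin 2 → ℝ → ℝ}

/-- The discounted value at the `n`-th switching time. -/
noncomputable def stoppedVal (a γ : Fin 2 → ℝ) (q m y : ℝ) (u : Fin 2 → ℝ → ℝ) (i : Fin 2)
    (x : ℝ) (n : ℕ) (s : ℕ → ℝ) : ℝ :=
  Real.exp (-(q * (skeleton a γ y i x s n).1)) *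
    stopVal u m y (stateAfter i n) (skeleton a γ y i x s n).2

theorem BackwardSystem.measurable_stoppedVal (h : BackwardSystem a γ lam q m y u) (i : Fin 2)
    (x : ℝ) (n : ℕ) : Measurable (stoppedVal a γ q m y u i x n) := by
  have h1 := measurable_skeleton a γ y i x n
  have h2 := (h.measurable_stopVal (stateAfter i n)).comp h1.snd
  unfold stoppedVal
  exact (Real.measurable_exp.comp (h1.fst.const_mul q).neg).mul h2

theorem BackwardSystem.stoppedVal_le (h : BackwardSystem a γ lam q m y u) {C : ℝ}
    (hC : ∀ j z, |stopVal u m y j z| ≤ C) (i : Fin 2) (x : ℝ) (n : ℕ) (s : ℕ → ℝ) :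
    |stoppedVal a γ q m y u i x n s| ≤ C := by
  rw [stoppedVal, abs_mul, Real.abs_exp]
  have h1 : Real.exp (-(q * (skeleton a γ y i x s n).1)) ≤ 1 := Real.exp_le_one_iff.2 (by
    have := mul_nonneg h.q_nonneg (skeleton_fst_nonneg a γ y i x s n)
    linarith)
  calc _ ≤ 1 * C := mul_le_mul h1 (hC _ _) (abs_nonneg _) zero_le_one
    _ = C := one_mul C

theorem stoppedVal_succ (i : Fin 2) (x : ℝ) (n : ℕ) (s : ℕ → ℝ) :
    stoppedVal a γ q m y u i x (n + 1) s = Real.exp (-(q * (skeleton a γ y i x s n).1)) *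
      stepVal a γ q m y u (stateAfter i n) (s n) (skeleton a γ y i x s n).2 := by
  simp only [stoppedVal, stepVal, skeleton, stateAfter_succ]
  rw [← mul_assoc, ← Real.exp_add]
  congr 2
  ring_nf

theorem BackwardSystem.integral_stoppedVal_succ (h : BackwardSystem a γ lam q m y u) (i : Fin 2)
    {x : ℝ} (hx : x ∈ Set.Icc m y) {S : ℕ → Ω → ℝ} (hS : ∀ n, Measurable (S n))
    (hmap : ∀ n, μ.map (S n) = expMeasure (lam (stateAfter i n))) (hind : iIndepFun S μ) (n : ℕ) :
    ∫ ω, stoppedVal a γ q m y u i x (n + 1) (fun k => S k ω) ∂μ =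
      ∫ ω, stoppedVal a γ q m y u i x n (fun k => S k ω) ∂μ := by
  obtain ⟨C, hC⟩ := h.exists_bound
  have hSm : Measurable fun ω k => S k ω := measurable_pi_lambda _ hS
  have hf : Measurable fun p : (ℝ × ℝ) × ℝ => Real.exp (-(q * p.1.1)) *
      stepVal a γ q m y u (stateAfter i n) p.2 p.1.2 := by
    have := (h.measurable_stepVal (stateAfter i n)).comp
      (measurable_snd.prodMk measurable_fst.snd : Measurable fun p : (ℝ × ℝ) × ℝ => (p.2, p.1.2))
    exact Measurable.mul (by fun_prop) this
  have hint : Integrable (fun ω => stoppedVal a γ q m y u i x (n + 1) fun k => S k ω) μ :=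
    Integrable.of_bound ((h.measurable_stoppedVal i x (n + 1)).comp hSm).aestronglyMeasurable C
      (ae_of_all _ fun ω => h.stoppedVal_le hC i x (n + 1) _)
  simp only [stoppedVal_succ] at hint ⊢
  refine (integral_comp_prod_of_indepFun ((measurable_skeleton a γ y i x n).comp hSm) (hS n)
    (indepFun_skeleton a γ y i x hS hind n) hf hint).trans ?_
  refine integral_congr_ae (ae_of_all _ fun ω => ?_)
  simp only [Function.comp]
  rw [integral_const_mul, hmap n, h.integral_stepVal _ (skeleton_snd_mem h.gamma_pos h.le_rho_zero
    h.rho_zero_le h.lt_rho_one i hx _ n), stoppedVal]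

theorem BackwardSystem.laplace_passageTime (h : BackwardSystem a γ lam q m y u) {i : Fin 2}
    {ε : ℝ → Ω → Fin 2} (hε : IsTwoStateChain μ lam i ε) {x : ℝ} (hmx : m ≤ x) (hxy : x < y)
    {X : ℝ → Ω → ℝ} (hX : IsKacOU μ a γ ε x X) :
    laplace μ (passageTime X y) q = u i x := by
  obtain ⟨S, hS, hmap, hind, hchain⟩ := hε
  obtain ⟨C, hC⟩ := h.exists_bound
  have hx : x ∈ Set.Icc m y := ⟨hmx, hxy.le⟩
  have hSm : Measurable fun ω k => S k ω := measurable_pi_lambda _ hS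
  have hconst : ∀ n, ∫ ω, stoppedVal a γ q m y u i x n (fun k => S k ω) ∂μ = u i x := by
    intro n
    induction n with
    | zero => simp [stoppedVal, skeleton, stateAfter_zero, stopVal_of_mem i ⟨hmx, hxy⟩]
    | succ n ih => rw [h.integral_stoppedVal_succ i hx hS hmap hind, ih]
  have hpos : ∀ᵐ ω ∂μ, ∀ n, 0 < S n ω := ae_all_iff.2 fun n =>
    ae_pos_of_map_eq_expMeasure (hS n) (h.lam_pos _) (hmap n)
  have hlong : ∀ᵐ ω ∂μ, ∃ n, stateAfter i n = 1 ∧ hitTime (rho a γ 1) (γ 1) y m ≤ S n ω := by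
    obtain ⟨g, hg, hg1⟩ := exists_injective_stateAfter_eq_one i
    filter_upwards [ae_exists_le_of_iIndepFun (fun n => hS (g n)) (hind.precomp hg) (h.lam_pos 1)
      (fun n => by rw [hmap, hg1]) (hitTime_nonneg (rho a γ 1) (γ 1) y m)] with ω ⟨n, hn⟩
    exact ⟨g n, hg1 n, hn⟩
  have hlim : ∀ᵐ ω ∂μ, Tendsto (fun n => stoppedVal a γ q m y u i x n fun k => S k ω) atTop
      (𝓝 (expNeg q (passageTime X y ω))) := by
    filter_upwards [hpos, hlong, hchain, hX] with ω hp ⟨n, hn1, hn⟩ hc ⟨hXc, hXe⟩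
    have hZ := skeleton_succ_snd_eq h.gamma_pos h.le_rho_zero h.rho_zero_le h.lt_rho_one hx
      (s := fun k => S k ω) hn1 hn
    have hθ0 := skeleton_fst_nonneg a γ y i x (fun k => S k ω) (n + 1)
    rcases skeleton_dichotomy (ε := fun t => ε t ω) (X := fun t => X t ω) h.gamma_pos h.rho_zero_le
      h.lt_rho_one hxy hp hc hXc hXe (n + 1) with hd | ⟨-, hXθ, hlt⟩
    · exact absurd hZ hd.1.ne
    -- Positivity matters because the passage time is an infimum over `t > 0`.
    have hθ : 0 < (skeleton a γ y i x (fun k => S k ω) (n + 1)).1 := by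
      refine hθ0.lt_of_ne fun h0 => ?_
      have hX0 : X 0 ω = x := by simpa using hXe 0 le_rfl
      rw [← h0] at hXθ
      exact hxy.ne (hX0.symm.trans hXθ)
    rw [passageTime_eq_ofReal hθ hXθ hlt, expNeg, if_neg ENNReal.ofReal_ne_top,
      ENNReal.toReal_ofReal hθ0]
    refine tendsto_const_nhds.congr' ?_
    filter_upwards [eventually_ge_atTop (n + 1)] with k hk
    rw [stoppedVal, skeleton_eq_of_le h.lt_rho_one hZ hk, hZ, stopVal_self, mul_one, neg_mul]
  have hdom := tendsto_integral_of_dominated_convergence (fun _ => C)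
    (fun n => ((h.measurable_stoppedVal i x n).comp hSm).aestronglyMeasurable)
    (integrable_const C) (fun n => ae_of_all μ fun ω => h.stoppedVal_le hC i x n _) hlim
  simp only [Function.comp, hconst] at hdom
  exact tendsto_nhds_unique hdom tendsto_const_nhds

end Stopping

/-! ### The explicit solution -/

section Explicit

variable {a γ lam : Fin 2 → ℝ} {q : ℝ}

theorem beta_pos (hγ : ∀ i, 0 < γ i) (hlam : ∀ i, 0 < lam i) (hq : 0 ≤ q) (i : Fin 2) :
    0 < beta γ lam q i := div_pos (by linarith [hlam i]) (hγ i)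

theorem b0_add_b1 (γ lam : Fin 2 → ℝ) (q : ℝ) :
    b0 γ lam q + b1 γ lam q = beta γ lam q 0 + beta γ lam q 1 := by
  unfold b0 b1
  ring

theorem b0_mul_b1 (hγ : ∀ i, 0 < γ i) (hlam : ∀ i, 0 < lam i) :
    b0 γ lam q * b1 γ lam q =
      beta γ lam q 0 * beta γ lam q 1 - lam 0 * lam 1 / (γ 0 * γ 1) := by
  have := hγ 0; have := hγ 1; have := hlam 0; have := hlam 1
  have hd : discr γ lam q ^ 2 =
      (beta γ lam q 0 - beta γ lam q 1) ^ 2 + 4 * lam 0 * lam 1 / (γ 0 * γ 1) :=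
    Real.sq_sqrt (by positivity)
  unfold b0 b1
  linear_combination -hd / 4

theorem b0_pos (hγ : ∀ i, 0 < γ i) (hlam : ∀ i, 0 < lam i) (hq : 0 ≤ q) : 0 < b0 γ lam q := by
  have h0 := beta_pos hγ hlam hq 0
  have h1 := beta_pos hγ hlam hq 1
  have h2 : 0 ≤ discr γ lam q := Real.sqrt_nonneg _
  unfold b0
  positivity

/-- The product `b₀ b₁` equals `q (q + λ₀ + λ₁) / (γ₀ γ₁)`, and `b₀ > 0`. -/
theorem b1_nonneg (hγ : ∀ i, 0 < γ i) (hlam : ∀ i, 0 < lam i) (hq : 0 ≤ q) :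
    0 ≤ b1 γ lam q := by
  have h := b0_mul_b1 (q := q) hγ hlam
  have := hγ 0; have := hγ 1; have := hlam 0; have := hlam 1
  have h' : b0 γ lam q * b1 γ lam q = (q * q + q * lam 0 + q * lam 1) / (γ 0 * γ 1) := by
    rw [h, beta, beta]
    field_simp
    ring
  exact nonneg_of_mul_nonneg_right (h' ▸ by positivity) (b0_pos hγ hlam hq)

/-- The explicit Laplace transforms of the first passage time through `y` from below. -/
noncomputable def passageLaplace (a γ lam : Fin 2 → ℝ) (q y : ℝ) (j : Fin 2) (z : ℝ) : ℝ :=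
  if j = 0 then lam 0 / (q + lam 0) *
    (F γ lam q (1 + beta γ lam q 0) (xi0 a γ z) / F γ lam q (beta γ lam q 0) (xi0 a γ y))
  else F γ lam q (beta γ lam q 0) (xi0 a γ z) / F γ lam q (beta γ lam q 0) (xi0 a γ y)

theorem passageLaplace_zero (a γ lam : Fin 2 → ℝ) (q y : ℝ) :
    passageLaplace a γ lam q y 0 = fun z => lam 0 / (q + lam 0) *
      (F γ lam q (1 + beta γ lam q 0) (xi0 a γ z) / F γ lam q (beta γ lam q 0) (xi0 a γ y)) := rfl

theorem passageLaplace_one (a γ lam : Fin 2 → ℝ) (q y : ℝ) :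
    passageLaplace a γ lam q y 1 = fun z =>
      F γ lam q (beta γ lam q 0) (xi0 a γ z) / F γ lam q (beta γ lam q 0) (xi0 a γ y) := rfl

theorem F_xi0_pos (hγ : ∀ i, 0 < γ i) (hlam : ∀ i, 0 < lam i) (hq : 0 ≤ q) {y : ℝ}
    (hy0 : rho a γ 0 ≤ y) (hy1 : y < rho a γ 1) :
    0 < F γ lam q (beta γ lam q 0) (xi0 a γ y) := by
  have h : 0 < rho a γ 1 - rho a γ 0 := by linarith
  refine zero_lt_one.trans_le (one_le_ordinaryHypergeometric (b0_pos hγ hlam hq)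
    (b1_nonneg hγ hlam hq) (beta_pos hγ hlam hq 0) ?_ ?_)
  · exact div_nonneg (by linarith) h.le
  · rw [xi0, div_lt_one h]
    linarith

theorem backwardSystem_passageLaplace (hγ : ∀ i, 0 < γ i) (hlam : ∀ i, 0 < lam i) (hq : 0 ≤ q)
    {m y : ℝ} (hm : m ≤ rho a γ 0) (hm' : 2 * rho a γ 0 - rho a γ 1 < m) (hy0 : rho a γ 0 ≤ y)
    (hy1 : y < rho a γ 1) :
    BackwardSystem a γ lam q m y (passageLaplace a γ lam q y) := by
  have hρ : 0 < rho a γ 1 - rho a γ 0 := by linarith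
  have hD := F_xi0_pos hγ hlam hq hy0 hy1
  refine ⟨hγ, hlam, hq, hm, hy0, hy1, fun j z hz => ?_, ?_⟩
  swap
  · simp [passageLaplace, hD.ne']
  have hξ : |xi0 a γ z| < 1 := by
    rw [xi0, abs_lt, lt_div_iff₀ hρ, div_lt_one hρ]
    constructor <;> linarith [hz.1, hz.2]
  obtain ⟨G', H', hG, hH, eG, eH⟩ := ordinaryHypergeometric_contiguous (b0_pos hγ hlam hq)
    (b1_nonneg hγ hlam hq) (beta_pos hγ hlam hq 0) hξ
  have hxi : HasDerivAt (xi0 a γ) (1 / (rho a γ 1 - rho a γ 0)) z :=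
    ((hasDerivAt_id z).sub_const _).div_const _
  have hG2 := hG.comp z hxi
  have hH2 := hH.comp z hxi
  have e0 : rho a γ 0 - z = -(xi0 a γ z) * (rho a γ 1 - rho a γ 0) := by
    rw [xi0]; field_simp; ring
  have e1 : rho a γ 1 - z = (1 - xi0 a γ z) * (rho a γ 1 - rho a γ 0) := by
    rw [xi0]; field_simp; ring
  have hβ0 : γ 0 * beta γ lam q 0 = q + lam 0 := by
    rw [beta, mul_div_cancel₀ _ (hγ 0).ne']
  have hβ1 : γ 1 * beta γ lam q 1 = q + lam 1 := by
    rw [beta, mul_div_cancel₀ _ (hγ 1).ne']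
  -- With `c = β₀`, one has `a + b - c = β₁` and `c (a + b - c) - a b = λ₀ λ₁ / (γ₀ γ₁)`, which are
  -- the coefficients of the state-`1` equation.
  rw [show b0 γ lam q + b1 γ lam q - beta γ lam q 0 = beta γ lam q 1 by rw [b0_add_b1]; ring,
    b0_mul_b1 hγ hlam, sub_sub_cancel] at eH
  have hq0 : q + lam 0 ≠ 0 := by linarith [hlam 0]
  have hβ0' := (beta_pos hγ hlam hq 0).ne'
  have hγ0 := (hγ 0).ne'
  have hγ1 := (hγ 1).ne'
  have eH' : γ 1 * ((1 - xi0 a γ z) * H') =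
      (q + lam 1) * F γ lam q (beta γ lam q 0) (xi0 a γ z) -
        lam 1 * (lam 0 / (q + lam 0)) * F γ lam q (1 + beta γ lam q 0) (xi0 a γ z) := by
    have h2 : beta γ lam q 0 * (γ 1 * ((1 - xi0 a γ z) * H')) = beta γ lam q 0 *
        ((q + lam 1) * F γ lam q (beta γ lam q 0) (xi0 a γ z) -
        lam 1 * (lam 0 / (q + lam 0)) * F γ lam q (1 + beta γ lam q 0) (xi0 a γ z)) := by
      rw [← hβ1, ← hβ0]
      unfold F
      field_simp at eH ⊢
      linear_combination eH
    exact mul_left_cancel₀ hβ0' h2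
  have eG' : γ 0 * (xi0 a γ z * G') = (q + lam 0) * (F γ lam q (beta γ lam q 0) (xi0 a γ z) -
      F γ lam q (1 + beta γ lam q 0) (xi0 a γ z)) := by
    rw [eG, ← mul_assoc, hβ0]
    rfl
  generalize hDd : F γ lam q (beta γ lam q 0) (xi0 a γ y) = D at hD
  have hD0 := hD.ne'
  fin_cases j
  · refine ⟨lam 0 / (q + lam 0) * (G' * (1 / (rho a γ 1 - rho a γ 0)) / D), ?_, ?_⟩
    · simp only [Fin.zero_eta, passageLaplace_zero, hDd]
      exact (hG2.div_const D).const_mul _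
    · simp only [Fin.zero_eta, sub_zero, passageLaplace_zero, passageLaplace_one, hDd, e0]
      have := hρ.ne'
      field_simp
      linear_combination -(lam 0) * eG'
  · refine ⟨H' * (1 / (rho a γ 1 - rho a γ 0)) / D, ?_, ?_⟩
    · simp only [Fin.mk_one, passageLaplace_one, hDd]
      exact hH2.div_const D
    · simp only [Fin.mk_one, sub_self, passageLaplace_zero, passageLaplace_one, hDd, e1]
      have := hρ.ne'
      field_simp at eH' ⊢
      linear_combination eH'

theorem laplace_passageTime_from_below {Ω : Type*} [MeasurableSpace Ω] {μ : Measure Ω}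
    [IsProbabilityMeasure μ] (hγ : ∀ i, 0 < γ i) (hlam : ∀ i, 0 < lam i) (hq : 0 ≤ q)
    {i : Fin 2} {ε : ℝ → Ω → Fin 2} (hε : IsTwoStateChain μ lam i ε) {x y : ℝ}
    {X : ℝ → Ω → ℝ} (hX : IsKacOU μ a γ ε x X) (hy0 : rho a γ 0 ≤ y) (hy1 : y < rho a γ 1)
    (hx : 2 * rho a γ 0 - rho a γ 1 < x) (hxy : x < y) :
    laplace μ (passageTime X y) q = passageLaplace a γ lam q y i x :=
  -- Here `m = min x ρ₀`: the interval `[m, y]` contains the start, cannot be left downwards, and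
  -- lies inside `|ξ₀| < 1`.
  (backwardSystem_passageLaplace hγ hlam hq (min_le_right x (rho a γ 0))
    (lt_min hx (by linarith)) hy0 hy1).laplace_passageTime hε (min_le_left _ _) hxy hX

end Explicit

/-! ### Reflection -/

section Reflection

theorem passageTime_neg {Ω : Type*} (X : ℝ → Ω → ℝ) (y : ℝ) :
    passageTime (fun t ω => -X t ω) (-y) = passageTime X y := by
  funext ω
  simp only [passageTime, neg_inj]

variable {Ω : Type*} [MeasurableSpace Ω] {μ : Measure Ω}

theorem stateAfter_one_sub (i : Fin 2) (n : ℕ) : stateAfter (1 - i) n = 1 - stateAfter i n := by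
  unfold stateAfter
  split_ifs <;> rfl

theorem IsTwoStateChain.reflect {lam : Fin 2 → ℝ} {i : Fin 2} {ε : ℝ → Ω → Fin 2}
    (h : IsTwoStateChain μ lam i ε) :
    IsTwoStateChain μ (fun j => lam (1 - j)) (1 - i) (fun t ω => 1 - ε t ω) := by
  obtain ⟨S, hS, hmap, hind, hc⟩ := h
  refine ⟨S, hS, fun n => ?_, hind, ?_⟩
  · simp only [stateAfter_one_sub, sub_sub_cancel, hmap]
  · filter_upwards [hc] with ω hω n t h1 h2
    rw [hω n t h1 h2, stateAfter_one_sub]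

theorem IsKacOU.reflect {a γ : Fin 2 → ℝ} {ε : ℝ → Ω → Fin 2} {x : ℝ} {X : ℝ → Ω → ℝ}
    (h : IsKacOU μ a γ ε x X) :
    IsKacOU μ (fun j => -a (1 - j)) (fun j => γ (1 - j)) (fun t ω => 1 - ε t ω) (-x)
      (fun t ω => -X t ω) := by
  filter_upwards [h] with ω ⟨hc, hX⟩
  refine ⟨hc.neg, fun t ht => ?_⟩
  rw [hX t ht, neg_add, ← intervalIntegral.integral_neg]
  congr 1
  refine intervalIntegral.integral_congr fun s _ => ?_
  simp only [sub_sub_cancel]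
  ring

theorem rho_reflect (a γ : Fin 2 → ℝ) (j : Fin 2) :
    rho (fun j => -a (1 - j)) (fun j => γ (1 - j)) j = -rho a γ (1 - j) := by
  simp only [rho, neg_div]

theorem xi0_reflect (a γ : Fin 2 → ℝ) (z : ℝ) :
    xi0 (fun j => -a (1 - j)) (fun j => γ (1 - j)) (-z) = xi1 a γ z := by
  simp only [xi0, xi1, rho_reflect, sub_zero, sub_self]
  congr 1 <;> ring

theorem beta_reflect (γ lam : Fin 2 → ℝ) (q : ℝ) (j : Fin 2) :
    beta (fun j => γ (1 - j)) (fun j => lam (1 - j)) q j = beta γ lam q (1 - j) := rfl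

/-- Both `b₀` and `b₁` are symmetric under exchanging the two states. -/
theorem F_reflect (γ lam : Fin 2 → ℝ) (q c z : ℝ) :
    F (fun j => γ (1 - j)) (fun j => lam (1 - j)) q c z = F γ lam q c z := by
  have hd : discr (fun j => γ (1 - j)) (fun j => lam (1 - j)) q = discr γ lam q := by
    simp only [discr, beta_reflect, sub_zero, sub_self]
    congr 1
    ring
  have h0 : b0 (fun j => γ (1 - j)) (fun j => lam (1 - j)) q = b0 γ lam q := by
    simp only [b0, hd, beta_reflect, sub_zero, sub_self]
    ring
  have h1 : b1 (fun j => γ (1 - j)) (fun j => lam (1 - j)) q = b1 γ lam q := by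
    simp only [b1, hd, beta_reflect, sub_zero, sub_self]
    ring
  rw [F, F, h0, h1]

/-- The process `-X` with exchanged states has attraction levels `-ρ₁ < -ρ₀` and approaches `-y`
from below. -/
theorem laplace_passageTime_from_above [IsProbabilityMeasure μ] {a γ lam : Fin 2 → ℝ} {q : ℝ}
    (hγ : ∀ i, 0 < γ i) (hlam : ∀ i, 0 < lam i) (hq : 0 ≤ q) {i : Fin 2} {ε : ℝ → Ω → Fin 2}
    (hε : IsTwoStateChain μ lam i ε) {x y : ℝ} {X : ℝ → Ω → ℝ} (hX : IsKacOU μ a γ ε x X)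
    (hy0 : rho a γ 0 < y) (hy1 : y ≤ rho a γ 1) (hxy : y < x)
    (hx : x < 2 * rho a γ 1 - rho a γ 0) :
    laplace μ (passageTime X y) q =
      passageLaplace (fun j => -a (1 - j)) (fun j => γ (1 - j)) (fun j => lam (1 - j)) q (-y)
        (1 - i) (-x) := by
  rw [← passageTime_neg]
  refine laplace_passageTime_from_below (fun i => hγ (1 - i)) (fun i => hlam (1 - i)) hq
    hε.reflect hX.reflect ?_ ?_ ?_ (neg_lt_neg hxy) <;>
  simp only [rho_reflect, sub_zero, sub_self] <;> linarith

end Reflection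

end KacOU

theorem mainTheorem1
    (a γ lam : Fin 2 → ℝ) (hγ : ∀ i, 0 < γ i) (hlam : ∀ i, 0 < lam i)
    (hρ : KacOU.rho a γ 0 < KacOU.rho a γ 1)
    (q : ℝ) (hq : 0 ≤ q)
    {Ω : Type*} [MeasurableSpace Ω]
    (P : Fin 2 → MeasureTheory.Measure Ω) [∀ i, MeasureTheory.IsProbabilityMeasure (P i)]
    (ε : ℝ → Ω → Fin 2) (hε : ∀ i, KacOU.IsTwoStateChain (P i) lam i ε)
    (x y : ℝ) (X : ℝ → Ω → ℝ) (hX : ∀ i, KacOU.IsKacOU (P i) a γ ε x X) :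
    (KacOU.rho a γ 0 ≤ y → y < KacOU.rho a γ 1 →
      2 * KacOU.rho a γ 0 - KacOU.rho a γ 1 < x → x < y →
        KacOU.laplace (P 0) (KacOU.passageTime X y) q =
          lam 0 / (q + lam 0) *
            (KacOU.F γ lam q (1 + KacOU.beta γ lam q 0) (KacOU.xi0 a γ x) /
              KacOU.F γ lam q (KacOU.beta γ lam q 0) (KacOU.xi0 a γ y)) ∧
        KacOU.laplace (P 1) (KacOU.passageTime X y) q =
          KacOU.F γ lam q (KacOU.beta γ lam q 0) (KacOU.xi0 a γ x) /
            KacOU.F γ lam q (KacOU.beta γ lam q 0) (KacOU.xi0 a γ y)) ∧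
    (KacOU.rho a γ 0 < y → y ≤ KacOU.rho a γ 1 →
      y < x → x < 2 * KacOU.rho a γ 1 - KacOU.rho a γ 0 →
        KacOU.laplace (P 0) (KacOU.passageTime X y) q =
          KacOU.F γ lam q (KacOU.beta γ lam q 1) (KacOU.xi1 a γ x) /
            KacOU.F γ lam q (KacOU.beta γ lam q 1) (KacOU.xi1 a γ y) ∧
        KacOU.laplace (P 1) (KacOU.passageTime X y) q =
          lam 1 / (q + lam 1) *
            (KacOU.F γ lam q (1 + KacOU.beta γ lam q 1) (KacOU.xi1 a γ x) /
              KacOU.F γ lam q (KacOU.beta γ lam q 1) (KacOU.xi1 a γ y))) := by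
  refine ⟨fun hy0 hy1 hx hxy => ⟨?_, ?_⟩, fun hy0 hy1 hxy hx => ⟨?_, ?_⟩⟩
  · rw [KacOU.laplace_passageTime_from_below hγ hlam hq (hε 0) (hX 0) hy0 hy1 hx hxy,
      KacOU.passageLaplace_zero]
  · rw [KacOU.laplace_passageTime_from_below hγ hlam hq (hε 1) (hX 1) hy0 hy1 hx hxy,
      KacOU.passageLaplace_one]
  · rw [KacOU.laplace_passageTime_from_above hγ hlam hq (hε 0) (hX 0) hy0 hy1 hxy hx,
      sub_zero, KacOU.passageLaplace_one]
    simp only [KacOU.F_reflect, KacOU.xi0_reflect, KacOU.beta_reflect, sub_zero]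
  · rw [KacOU.laplace_passageTime_from_above hγ hlam hq (hε 1) (hX 1) hy0 hy1 hxy hx,
      sub_self, KacOU.passageLaplace_zero]
    simp only [KacOU.F_reflect, KacOU.xi0_reflect, KacOU.beta_reflect, sub_zero]
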